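/- Let $\gamma^0,\dots,\gamma^3$ be the Dirac matrices, let $m,e\in\mathbb R$, and let $A:\mathbb R^4\to\mathbb R^4$ be a smooth, compactly supported four-vector potential. A Cauchy surface is a smooth 3-dimensional submanifold $\Sigma\subset\mathbb R^4$ of Minkowski space with space-like tangent spaces that meets every inextensible, two-sided, time- or light-like continuous path in exactly one point; $\mathcal H_\Sigma=L^2(\Sigma,\mathbb C^4)$ is the Hilbert space with scalar product $\langle\phi,\psi\rangle=\int_\Sigma\overline{\phi(x)}\,i_\gamma(d^4x)\,\psi(x)$, where $\overline\phi=\phi^\dagger\gamma^0$ and $i_\gamma(d^4x)$ is the contraction of the volume form with $\gamma^\mu$. For Cauchy surfaces $\Sigma,\Sigma'$ let $U^A_{\Sigma'\Sigma}:\mathcal H_\Sigma\to\mathcal H_{\Sigma'}$ be the one-particle Dirac evolution, i.e. the unitary map with $U^A_{\Sigma'\Sigma}(\psi|_\Sigma)=\psi|_{\Sigma'}$ for all smooth solutions $\psi$ of $(i\gamma^\mu\partial_\mu-m)\psi=e\gamma^\mu A_\mu\psi$ for which $\psi|_\Sigma$ is compactly supported and $\psi$ is supported in the forward and backward light cone of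 $\operatorname{supp}\psi|_\Sigma$. A polarization of a Hilbert space $\mathcal H$ is a closed subspace $V$ such that $V$ and $V^\perp$ are both infinite dimensional; $P^V$ denotes the orthogonal projection onto $V$. For a polarization $V$ of $\mathcal H_\Sigma$ let $$\mathcal F(V,\Sigma)=\bigoplus_{c\in\mathbb Z}\ \bigoplus_{\substack{n,k\ge 0\\ c=k-n}}(V^\perp)^{\wedge n}\otimes\overline V^{\wedge k}$$ (Hilbert space sums, antisymmetric powers and tensor products, $\overline V$ the complex conjugate space of $V$), and for $f\in\mathcal H_\Sigma$ let $a^*_\Sigma(f)=b^*(P^{V^\perp}f)+c^*(P^Vf)$ be the creation operator on $\mathcal F(V,\Sigma)$, where $b^*(g)$ is the exterior multiplication by $g$ in the first factor, and $c^*(g)$ is $(-1)^n$ times the adjoint of the exterior multiplication by $g\in\overline V$ in the second factor. **Corollary.** Let $\Sigma,\Sigma'$ be Cauchy surfaces, and let $V$ and $V'$ be polarizations of $\mathcal H_\Sigma$ and $\mathcal H_{\Sigma'}$. The following statements are equivalent: (a) There is a unitary operator $\widetilde U:\mathcal F(V,\Sigma)\to\mathcal F(V',\Sigma')$ such that $\widetilde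 U\,a^*_\Sigma(f)\,\widetilde U^{-1}=a^*_{\Sigma'}(U^A_{\Sigma'\Sigma}f)$ for all $f\in\mathcal H_\Sigma$. (b) The off-diagonal operators $P^{V'^\perp}U^A_{\Sigma'\Sigma}P^V$ and $P^{V'}U^A_{\Sigma'\Sigma}P^{V^\perp}$ are Hilbert–Schmidt operators. -/

import Mathlib

open MeasureTheory Filter Topology
open scoped ContDiff TensorProduct ComplexConjugate InnerProductSpace

noncomputable section

namespace DiracSea

/-! ### Antisymmetric Fock space over a complex inner product space -/

section Fock

variable (K : Type*) [NormedAddCommGroup K] [InnerProductSpace ℂ K]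

/-- The exterior algebra `⨁ₙ Kᐱⁿ` (algebraic direct sum). -/
def Wedge : Type _ := ExteriorAlgebra ℂ K

instance : Ring (Wedge K) := inferInstanceAs (Ring (ExteriorAlgebra ℂ K))
instance : Algebra ℂ (Wedge K) := inferInstanceAs (Algebra ℂ (ExteriorAlgebra ℂ K))

variable {K}

/-- The inclusion of `K` as the degree one part. -/
def Wedge.ι : K →ₗ[ℂ] Wedge K := ExteriorAlgebra.ι ℂ

/-- Interior multiplication by `⟪f, ·⟫`: the antiderivation with `f ⌋ g = ⟪f, g⟫`. -/
def Wedge.contract (f : K) : Wedge K →ₗ[ℂ] Wedge K :=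
  CliffordAlgebra.contractLeft (Q := (0 : QuadraticForm ℂ K)) (innerₛₗ ℂ f)

/-- The coefficient of the vacuum `1`. -/
def Wedge.vac : Wedge K →ₐ[ℂ] ℂ := ExteriorAlgebra.algebraMapInv

/-- The grading automorphism `(-1)^n` on `Kᐱⁿ`. -/
def Wedge.invol : Wedge K →ₐ[ℂ] Wedge K :=
  CliffordAlgebra.involute (Q := (0 : QuadraticForm ℂ K))

namespace Wedge

theorem induction {P : Wedge K → Prop} (hr : ∀ r : ℂ, P (algebraMap ℂ _ r))
    (hadd : ∀ x y, P x → P y → P (x + y)) (hmul : ∀ (f : K) x, P x → P (ι f * x)) (x : Wedge K) :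
    P x :=
  CliffordAlgebra.left_induction (Q := (0 : QuadraticForm ℂ K)) hr hadd
    (fun x m hx => hmul m x hx) x

@[simp] theorem contract_algebraMap (f : K) (r : ℂ) :
    contract f (algebraMap ℂ (Wedge K) r) = 0 :=
  CliffordAlgebra.contractLeft_algebraMap _ _ _

@[simp] theorem contract_one (f : K) : contract f (1 : Wedge K) = 0 := by
  simpa using contract_algebraMap f 1

theorem contract_ι_mul (f g : K) (x : Wedge K) :
    contract f (ι g * x) = (inner ℂ f g : ℂ) • x - ι g * contract f x :=
  CliffordAlgebra.contractLeft_ι_mul _ _ _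

theorem contract_contract (f : K) (x : Wedge K) : contract f (contract f x) = 0 :=
  CliffordAlgebra.contractLeft_contractLeft _ _

theorem contract_add (f g : K) (x : Wedge K) :
    contract (f + g) x = contract f x + contract g x := by
  simp only [contract, map_add]
  rfl

theorem contract_smul (c : ℂ) (f : K) (x : Wedge K) :
    contract (c • f) x = conj c • contract f x := by
  simp only [contract, LinearMap.map_smulₛₗ]
  rfl

@[simp] theorem vac_ι_mul (f : K) (x : Wedge K) : vac (ι f * x) = 0 := by
  have : vac (ι f) = (0 : ℂ) := by
    exact ExteriorAlgebra.lift_ι_apply ℂ _ _ _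
  rw [map_mul, this, zero_mul]

theorem ι_mul_ι_mul (f : K) (x : Wedge K) : ι f * (ι f * x) = 0 := by
  have : (ι f * ι f : Wedge K) = 0 := ExteriorAlgebra.ι_sq_zero f
  rw [← mul_assoc, this, zero_mul]

@[simp] theorem invol_ι (f : K) : invol (ι f) = -(ι f : Wedge K) :=
  CliffordAlgebra.involute_ι _

theorem vac_invol (x : Wedge K) : vac (invol x) = vac x := by
  induction x using Wedge.induction with
  | hr r => simp
  | hadd x y hx hy => simp [hx, hy]
  | hmul f x hx => simp

theorem contract_invol (f : K) (x : Wedge K) :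
    contract f (invol x) = -invol (contract f x) := by
  induction x using Wedge.induction with
  | hr r => simp
  | hadd x y hx hy => simp only [map_add, hx, hy, neg_add]
  | hmul g x hx =>
    rw [map_mul, invol_ι, neg_mul, map_neg, contract_ι_mul, contract_ι_mul, hx]
    simp

/-- Wedging by `f` on the right-hand slot, viewed on conjugate-linear functionals: the transpose of
`contract f`. -/
def dualMul : K →ₗ[ℂ] Module.End ℂ (Wedge K →ₛₗ[starRingEnd ℂ] ℂ) where
  toFun f :=
    { toFun := fun ℓ => ℓ.comp (contract f)
      map_add' := fun _ _ => rfl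
      map_smul' := fun _ _ => rfl }
  map_add' f g := by
    ext ℓ x
    simp [contract_add]
  map_smul' c f := by
    ext ℓ x
    simp [contract_smul]

/-- The action of the exterior algebra on conjugate-linear functionals generated by `dualMul`. -/
def dualAct : Wedge K →ₐ[ℂ] Module.End ℂ (Wedge K →ₛₗ[starRingEnd ℂ] ℂ) :=
  ExteriorAlgebra.lift ℂ ⟨dualMul, fun f => by
    ext ℓ x
    simp [dualMul, contract_contract]⟩

/-- The conjugate-linear functional `x ↦ ⟪x, 1⟫`. -/
def vacConj : Wedge K →ₛₗ[starRingEnd ℂ] ℂ where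
  toFun x := conj (vac x)
  map_add' x y := by simp
  map_smul' c x := by simp

/-- The sesquilinear form on the exterior algebra, determined by `⟪x, 1⟫ = conj (vac x)` and
`⟪x, f ∧ y⟫ = ⟪f ⌋ x, y⟫`; on products of vectors it is the Gram determinant,
`⟪f₁ ∧ … ∧ fₙ, g₁ ∧ … ∧ gₘ⟫ = δₙₘ det ⟪fᵢ, gⱼ⟫`. -/
def form (x y : Wedge K) : ℂ := dualAct y vacConj x

@[simp] theorem form_add_left (x y z : Wedge K) : form (x + y) z = form x z + form y z := by
  simp [form]

@[simp] theorem form_add_right (x y z : Wedge K) : form x (y + z) = form x y + form x z := by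
  simp [form]

@[simp] theorem form_smul_left (c : ℂ) (x z : Wedge K) : form (c • x) z = conj c * form x z := by
  simp [form]

@[simp] theorem form_smul_right (c : ℂ) (x z : Wedge K) : form x (c • z) = c * form x z := by
  simp [form]

@[simp] theorem form_neg_left (x z : Wedge K) : form (-x) z = -form x z := by
  simp [form]

@[simp] theorem form_neg_right (x z : Wedge K) : form x (-z) = -form x z := by
  simp [form]

@[simp] theorem form_zero_left (z : Wedge K) : form 0 z = 0 := by simp [form]

@[simp] theorem form_zero_right (z : Wedge K) : form z 0 = 0 := by simp [form]

@[simp] theorem form_algebraMap_right (x : Wedge K) (r : ℂ) :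
    form x (algebraMap ℂ _ r) = r * conj (vac x) := by
  simp [form, vacConj]

theorem form_ι_mul_right (f : K) (x y : Wedge K) : form x (ι f * y) = form (contract f x) y := by
  have : dualAct (ι f) = (dualMul f : Module.End ℂ (Wedge K →ₛₗ[starRingEnd ℂ] ℂ)) :=
    ExteriorAlgebra.lift_ι_apply _ _ _ _
  rw [form, map_mul, this]
  rfl

theorem form_sub_left (x y z : Wedge K) : form (x - y) z = form x z - form y z := by
  simp [form]

theorem form_sub_right (x y z : Wedge K) : form x (y - z) = form x y - form x z := by
  simp [form]

theorem form_ι_mul_left (f : K) (x y : Wedge K) : form (ι f * x) y = form x (contract f y) := by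
  induction y using Wedge.induction generalizing x with
  | hr r => rw [form_algebraMap_right, contract_algebraMap]; simp [form_zero_right]
  | hadd y z hy hz => simp [hy, hz]
  | hmul g y hy =>
    rw [form_ι_mul_right, contract_ι_mul, contract_ι_mul, form_sub_left, form_sub_right,
      form_smul_left, form_smul_right, hy, form_ι_mul_right, inner_conj_symm]

theorem form_algebraMap_left (x : Wedge K) (r : ℂ) :
    form (algebraMap ℂ _ r) x = conj r * vac x := by
  induction x using Wedge.induction with
  | hr s => simp [mul_comm]
  | hadd y z hy hz => simp [hy, hz, mul_add]
  | hmul g y hy => rw [form_ι_mul_right]; simp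

theorem conj_form (x y : Wedge K) : conj (form y x) = form x y := by
  induction y using Wedge.induction generalizing x with
  | hr r => simp [form_algebraMap_left]
  | hadd y z hy hz => simp [hy, hz]
  | hmul g y hy => rw [form_ι_mul_left, form_ι_mul_right, hy]

theorem form_invol (x y : Wedge K) : form (invol x) (invol y) = form x y := by
  induction y using Wedge.induction generalizing x with
  | hr r => simp [vac_invol]
  | hadd y z hy hz => simp [hy, hz]
  | hmul g y hy =>
    rw [map_mul, invol_ι, neg_mul, form_neg_right, form_ι_mul_right, contract_invol,
      form_neg_left, hy, form_ι_mul_right, neg_neg]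

/-- The span of the products of the vectors of a list. -/
def listSpan : List K → Submodule ℂ (Wedge K)
  | [] => Submodule.span ℂ {1}
  | e :: l => listSpan l ⊔ (listSpan l).map (LinearMap.mulLeft ℂ (ι e))

theorem contract_listSpan (e : K) (l : List K) (h : ∀ f ∈ l, inner ℂ e f = (0 : ℂ))
    (x : Wedge K) (hx : x ∈ listSpan l) : contract e x = 0 := by
  induction l generalizing x with
  | nil =>
    obtain ⟨c, rfl⟩ := Submodule.mem_span_singleton.1 hx
    simp
  | cons f l ih =>
    obtain ⟨y, hy, z, hz, rfl⟩ := Submodule.mem_sup.1 hx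
    obtain ⟨w, hw, rfl⟩ := hz
    have h1 := ih (fun g hg => h g (by simp [hg])) y hy
    have h2 := ih (fun g hg => h g (by simp [hg])) w hw
    simp [contract_ι_mul, h1, h2, h f (by simp)]

theorem form_self_nonneg_of_listSpan (l : List K)
    (h : l.Pairwise fun e f => inner ℂ e f = (0 : ℂ)) (x : Wedge K) (hx : x ∈ listSpan l) :
    0 ≤ (form x x).re := by
  induction l generalizing x with
  | nil =>
    obtain ⟨c, rfl⟩ := Submodule.mem_span_singleton.1 hx
    rw [← Algebra.algebraMap_eq_smul_one, form_algebraMap_right, AlgHom.commutes]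
    simpa using add_nonneg (mul_self_nonneg c.re) (mul_self_nonneg c.im)
  | cons e l ih =>
    rw [List.pairwise_cons] at h
    obtain ⟨y, hy, z, hz, rfl⟩ := Submodule.mem_sup.1 hx
    obtain ⟨w, hw, rfl⟩ := hz
    have h1 := contract_listSpan e l h.1 y hy
    have h2 := contract_listSpan e l h.1 w hw
    have h3 := ih h.2 y hy
    have h4 := ih h.2 w hw
    have h5 : form (y + ι e * w) (y + ι e * w) = form y y + ((‖e‖ ^ 2 : ℝ) : ℂ) * form w w := by
      simp [form_ι_mul_left, form_ι_mul_right, contract_ι_mul, h1, h2,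
        inner_self_eq_norm_sq_to_K]
    simp only [LinearMap.mulLeft_apply]
    rw [h5, Complex.add_re, Complex.re_ofReal_mul]
    positivity

theorem one_mem_listSpan (l : List K) : (1 : Wedge K) ∈ listSpan l := by
  induction l with
  | nil => exact Submodule.mem_span_singleton_self _
  | cons e l ih => exact Submodule.mem_sup_left ih

theorem ι_mul_mem_listSpan (l : List K) (f : K) (hf : f ∈ l) (x : Wedge K)
    (hx : x ∈ listSpan l) : ι f * x ∈ listSpan l := by
  induction l generalizing x with
  | nil => simp at hf
  | cons e l ih =>
    obtain ⟨y, hy, z, hz, rfl⟩ := Submodule.mem_sup.1 hx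
    obtain ⟨w, hw, rfl⟩ := hz
    simp only [LinearMap.mulLeft_apply, mul_add]
    rcases List.mem_cons.1 hf with rfl | hf
    · rw [ι_mul_ι_mul, add_zero]
      exact Submodule.mem_sup_right ⟨y, hy, rfl⟩
    · have h1 := ih hf y hy
      have h2 := ih hf w hw
      have h3 : (ι f * (ι e * w) : Wedge K) = -(ι e * (ι f * w)) := by
        have : (ι f * ι e + ι e * ι f : Wedge K) = 0 := ExteriorAlgebra.ι_add_mul_swap f e
        rw [← mul_assoc, ← mul_assoc, eq_neg_of_add_eq_zero_left this, neg_mul]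
      rw [h3]
      exact add_mem (Submodule.mem_sup_left h1)
        (neg_mem (Submodule.mem_sup_right ⟨_, h2, rfl⟩))

theorem span_mul_mem_listSpan (l : List K) (f : K) (hf : f ∈ Submodule.span ℂ {f | f ∈ l})
    (x : Wedge K) (hx : x ∈ listSpan l) : ι f * x ∈ listSpan l := by
  induction hf using Submodule.span_induction with
  | mem g hg => exact ι_mul_mem_listSpan l g hg x hx
  | zero => simp
  | add g g' _ _ hg hg' =>
    rw [map_add, add_mul]
    exact add_mem hg hg'
  | smul c g _ hg =>
    rw [map_smul, smul_mul_assoc]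
    exact Submodule.smul_mem _ _ hg

theorem exists_listSpan (x : Wedge K) : ∃ S : Submodule ℂ K, FiniteDimensional ℂ S ∧
    ∀ l : List K, S ≤ Submodule.span ℂ {f | f ∈ l} → x ∈ listSpan l := by
  induction x using Wedge.induction with
  | hr r =>
    refine ⟨⊥, inferInstance, fun l _ => ?_⟩
    rw [Algebra.algebraMap_eq_smul_one]
    exact Submodule.smul_mem _ _ (one_mem_listSpan l)
  | hadd x y hx hy =>
    obtain ⟨S, hS, h⟩ := hx
    obtain ⟨T, hT, h'⟩ := hy
    exact ⟨S ⊔ T, inferInstance, fun l hl =>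
      add_mem (h l (le_sup_left.trans hl)) (h' l (le_sup_right.trans hl))⟩
  | hmul f x hx =>
    obtain ⟨S, hS, h⟩ := hx
    refine ⟨Submodule.span ℂ {f} ⊔ S, inferInstance, fun l hl => ?_⟩
    have h1 := h l (le_sup_right.trans hl)
    have h2 : f ∈ Submodule.span ℂ {f | f ∈ l} :=
      hl (Submodule.mem_sup_left (Submodule.mem_span_singleton_self f))
    exact span_mul_mem_listSpan l f h2 x h1

theorem form_self_nonneg (x : Wedge K) : 0 ≤ (form x x).re := by
  obtain ⟨S, hS, h⟩ := exists_listSpan x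
  let b := stdOrthonormalBasis ℂ S
  refine form_self_nonneg_of_listSpan (List.ofFn fun i => (b i : K)) ?_ x (h _ ?_)
  · rw [List.pairwise_ofFn]
    intro i j hij
    simpa using b.orthonormal.2 hij.ne
  · intro f hf
    have h1 := b.toBasis.mem_span ⟨f, hf⟩
    have h2 := Submodule.mem_map_of_mem (f := S.subtype) h1
    rw [Submodule.map_span] at h2
    refine Submodule.span_mono ?_ h2
    rintro _ ⟨_, ⟨i, rfl⟩, rfl⟩
    simp

end Wedge

/-- The positive (semi)definite Gram form on the exterior algebra. -/
@[reducible] def Wedge.core : PreInnerProductSpace.Core ℂ (Wedge K) where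
  inner := Wedge.form
  conj_inner_symm := Wedge.conj_form
  re_inner_nonneg := Wedge.form_self_nonneg
  add_left := Wedge.form_add_left
  smul_left x y r := Wedge.form_smul_left r x y

instance : SeminormedAddCommGroup (Wedge K) :=
  InnerProductSpace.Core.toSeminormedAddCommGroup (𝕜 := ℂ) (c := Wedge.core)

instance : InnerProductSpace ℂ (Wedge K) := InnerProductSpace.ofCore Wedge.core

theorem Wedge.inner_eq (x y : Wedge K) : inner ℂ x y = Wedge.form x y := rfl

variable (K) in
/-- The antisymmetric Fock space `⨁ₙ Kᐱⁿ` (Hilbert space direct sum of the antisymmetric Hilbert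
space powers of `K`): the completion of the exterior algebra for the Gram inner product. -/
abbrev AFock : Type _ := UniformSpace.Completion (Wedge K)

theorem Wedge.norm_ι_mul_le (f : K) (x : Wedge K) : ‖Wedge.ι f * x‖ ≤ ‖f‖ * ‖x‖ := by
  refine le_of_sq_le_sq ?_ (by positivity)
  have h1 : Wedge.form (Wedge.ι f * x) (Wedge.ι f * x) =
      ((‖f‖ ^ 2 : ℝ) : ℂ) * Wedge.form x x -
        Wedge.form (Wedge.contract f x) (Wedge.contract f x) := by
    rw [Wedge.form_ι_mul_left, Wedge.contract_ι_mul, Wedge.form_sub_right,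
      Wedge.form_smul_right, Wedge.form_ι_mul_right, inner_self_eq_norm_sq_to_K]
    simp
  have h2 := Wedge.form_self_nonneg (Wedge.contract f x)
  rw [mul_pow, @norm_sq_eq_re_inner ℂ, @norm_sq_eq_re_inner ℂ _ _ _ _ x, Wedge.inner_eq,
    Wedge.inner_eq, h1]
  simp only [RCLike.re_to_complex, Complex.sub_re, Complex.re_ofReal_mul]
  linarith

/-- The creation operator `x ↦ f ∧ x` on the antisymmetric Fock space. -/
def AFock.create (f : K) : AFock K →L[ℂ] AFock K :=
  ((LinearMap.mulLeft ℂ (Wedge.ι f)).mkContinuous ‖f‖ (Wedge.norm_ι_mul_le f)).completion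

/-- The annihilation operator, the adjoint of the creation operator. -/
def AFock.annihilate (f : K) : AFock K →L[ℂ] AFock K :=
  ContinuousLinearMap.adjoint (AFock.create f)

theorem Wedge.norm_invol (x : Wedge K) : ‖Wedge.invol x‖ = ‖x‖ := by
  rw [@norm_eq_sqrt_re_inner ℂ, @norm_eq_sqrt_re_inner ℂ _ _ _ _ x, Wedge.inner_eq, Wedge.inner_eq,
    Wedge.form_invol]

variable (K) in
/-- The parity operator `(-1)^N`, equal to `(-1)^n` on `Kᐱⁿ`. -/
def AFock.parity : AFock K →L[ℂ] AFock K :=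
  ((Wedge.invol (K := K)).toLinearMap.mkContinuous 1
    fun x => by simp [Wedge.norm_invol]).completion

end Fock

/-! ### The complex conjugate Hilbert space -/

/-- The complex conjugate of a complex inner product space: the same additive group and norm, with
scalar multiplication `λ ⋆ g = conj λ • g` and inner product `⟪g, h⟫⋆ = ⟪h, g⟫`. -/
def ConjSpace (E : Type*) : Type _ := E

namespace ConjSpace

variable {E : Type*} [NormedAddCommGroup E] [InnerProductSpace ℂ E]

instance : NormedAddCommGroup (ConjSpace E) := inferInstanceAs (NormedAddCommGroup E)

instance : Module ℂ (ConjSpace E) := Module.compHom E (starRingEnd ℂ)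

/-- The identity map from a space to its complex conjugate. -/
def of : E ≃+ ConjSpace E := AddEquiv.refl E

theorem smul_of (c : ℂ) (x : E) : c • of x = of (conj c • x) := rfl

instance : InnerProductSpace ℂ (ConjSpace E) where
  norm_smul_le c x := by
    change ‖(conj c • (of.symm x) : E)‖ ≤ ‖c‖ * ‖(of.symm x : E)‖
    simp [norm_smul]
  inner x y := inner ℂ (of.symm y : E) (of.symm x : E)
  norm_sq_eq_re_inner x := norm_sq_eq_re_inner (𝕜 := ℂ) (of.symm x : E)
  conj_inner_symm x y := inner_conj_symm (𝕜 := ℂ) (of.symm y : E) (of.symm x : E)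
  add_left x y z := inner_add_right (𝕜 := ℂ) (of.symm z : E) (of.symm x : E) (of.symm y : E)
  smul_left x y c :=
    inner_smul_right (𝕜 := ℂ) (of.symm y : E) (of.symm x : E) (conj c)

instance [CompleteSpace E] : CompleteSpace (ConjSpace E) := inferInstanceAs (CompleteSpace E)

end ConjSpace

/-! ### Polarizations, the Fock space of a polarization, Hilbert–Schmidt operators -/

section Polarization

variable {H : Type*} [NormedAddCommGroup H] [InnerProductSpace ℂ H] [CompleteSpace H]
variable {H' : Type*} [NormedAddCommGroup H'] [InnerProductSpace ℂ H'] [CompleteSpace H']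

variable (H) in
/-- A polarization of a Hilbert space: a closed subspace `V` such that `V` and its orthogonal
complement are both infinite dimensional. -/
structure Polarization where
  /-- The underlying subspace. -/
  V : Submodule ℂ H
  isClosed : IsClosed (V : Set H)
  infinite : ¬ FiniteDimensional ℂ V
  infinite_orthogonal : ¬ FiniteDimensional ℂ Vᗮ

instance (W : Polarization H) : CompleteSpace W.V := W.isClosed.completeSpace_coe

/-- The Fock space `𝓕(V) = 𝓕ₑ ⊗ 𝓕ₕ`, the Hilbert space tensor product of the antisymmetric Fock
spaces `𝓕ₑ = ⨁ₙ (Vᗮ)ᐱⁿ` and `𝓕ₕ = ⨁ₘ (conj V)ᐱᵐ`; equivalently the Hilbert space direct sum of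
all `(Vᗮ)ᐱⁿ ⊗ (conj V)ᐱᵐ` (which may be grouped according to the charge `m - n`). -/
abbrev FockSpace (W : Polarization H) : Type _ :=
  UniformSpace.Completion (AFock W.Vᗮ ⊗[ℂ] AFock (ConjSpace W.V))

/-- The creation operator `a*(f) = b*(P^{Vᗮ} f) + c*(P^V f)` on `𝓕(V)`. Here `b*` creates an electron
in `𝓕ₑ`, and `c*(g) = (d*(g))*` annihilates a hole in `𝓕ₕ`, with the sign `(-1)^n` from moving `g`
past `n` electrons. -/
def FockSpace.create (W : Polarization H) (f : H) : FockSpace W →L[ℂ] FockSpace W :=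
  (TensorProduct.mapL (AFock.create (W.Vᗮ.orthogonalProjectionOnto f))
    (ContinuousLinearMap.id ℂ (AFock (ConjSpace W.V)))).completion +
  (TensorProduct.mapL (AFock.parity W.Vᗮ)
    (AFock.annihilate (ConjSpace.of (W.V.orthogonalProjectionOnto f)))).completion

/-- A bounded operator `T` is Hilbert–Schmidt if `∑ᵢ ‖T eᵢ‖² < ∞` for an orthonormal (Hilbert) basis
`(eᵢ)` of its domain. -/
def IsHilbertSchmidt (T : H →L[ℂ] H') : Prop :=
  ∃ (w : Set H) (b : HilbertBasis w ℂ H), Summable fun i => ‖T (b i)‖ ^ 2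

end Polarization

/-! ### Minkowski space, Cauchy surfaces and their one-particle Hilbert spaces -/

/-- Space-time `ℝ⁴`, with coordinates `(x⁰, x¹, x², x³)`. -/
abbrev Spacetime : Type := Fin 4 → ℝ

/-- Four-spinors `ℂ⁴`. -/
abbrev Spinor : Type := EuclideanSpace ℂ (Fin 4)

/-- The Minkowski square `(v⁰)² - (v¹)² - (v²)² - (v³)²`. -/
def minkowskiSq (v : Spacetime) : ℝ := v 0 ^ 2 - v 1 ^ 2 - v 2 ^ 2 - v 3 ^ 2

/-- Continuous time- or light-like (causal) paths: the difference of any two points of the path is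
a nonzero time- or light-like vector. -/
def IsCausalPath (c : ℝ → Spacetime) : Prop :=
  Continuous c ∧ ∀ s t, s < t → c s ≠ c t ∧ 0 ≤ minkowskiSq (c t - c s)

/-- The path has no end point in either direction. -/
def IsInextensible (c : ℝ → Spacetime) : Prop :=
  (¬ ∃ p, Tendsto c atTop (𝓝 p)) ∧ ¬ ∃ p, Tendsto c atBot (𝓝 p)

/-- The tangent vectors of a subset `S` at `p`: the velocities of curves in `S` through `p`. For
a smooth submanifold these form the tangent space. -/
def tangentVectors (S : Set Spacetime) (p : Spacetime) : Set Spacetime :=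
  {v | ∃ c : ℝ → Spacetime, (∀ s, c s ∈ S) ∧ c 0 = p ∧ HasDerivAt c v 0}

/-- `S` is a smooth three-dimensional (embedded) submanifold of `ℝ⁴`: locally it is the zero set of
a smooth function with nonvanishing differential. -/
def IsSmoothHypersurface (S : Set Spacetime) : Prop :=
  ∀ p ∈ S, ∃ (U : Set Spacetime) (F : Spacetime → ℝ), IsOpen U ∧ p ∈ U ∧ ContDiffOn ℝ ∞ F U ∧
    (∀ q ∈ U, fderiv ℝ F q ≠ 0) ∧ ∀ q ∈ U, q ∈ S ↔ F q = 0

/-- Cauchy surfaces in Minkowski space. -/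
structure CauchySurface where
  /-- The underlying set of points. -/
  carrier : Set Spacetime
  smooth : IsSmoothHypersurface carrier
  existsUnique_inter : ∀ c, IsCausalPath c → IsInextensible c →
    ∃! p, p ∈ carrier ∧ p ∈ Set.range c
  spacelike : ∀ p ∈ carrier, ∀ v ∈ tangentVectors carrier p, v ≠ 0 → minkowskiSq v < 0

/-- The Dirac matrices `γ^μ` (standard representation). -/
def gamma : Fin 4 → Matrix (Fin 4) (Fin 4) ℂ :=
  ![!![1, 0, 0, 0; 0, 1, 0, 0; 0, 0, -1, 0; 0, 0, 0, -1],
    !![0, 0, 0, 1; 0, 0, 1, 0; 0, -1, 0, 0; -1, 0, 0, 0],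
    !![0, 0, 0, -Complex.I; 0, 0, Complex.I, 0; 0, Complex.I, 0, 0; -Complex.I, 0, 0, 0],
    !![0, 0, 1, 0; 0, 0, 0, -1; -1, 0, 0, 0; 0, 1, 0, 0]]

/-- A matrix acting on spinors. -/
def act (M : Matrix (Fin 4) (Fin 4) ℂ) : Spinor →ₗ[ℂ] Spinor := Matrix.toEuclideanLin M

/-- The contraction `i_γ(d⁴x) = ∑_μ γ^μ d⁴x(e_μ, ·, ·, ·)` of the volume form
`d⁴x = dx⁰ ∧ dx¹ ∧ dx² ∧ dx³` with the matrix-valued vector `γ`, evaluated on three vectors. -/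
def gammaForm (v : Fin 3 → Spacetime) : Matrix (Fin 4) (Fin 4) ℂ :=
  ∑ μ, ((Matrix.det (Matrix.of (Fin.cons (Pi.single μ 1) v : Fin 4 → Spacetime)) : ℝ) : ℂ) • gamma μ

namespace CauchySurface

/-- The vertical line over `x ∈ ℝ³` is an inextensible causal path. -/
theorem exists_time (S : CauchySurface) (x : Fin 3 → ℝ) :
    ∃ t : ℝ, (Fin.cons t x : Spacetime) ∈ S.carrier := by
  have hc : Continuous fun t : ℝ => (Fin.cons t x : Spacetime) := by
    refine continuous_pi fun i => ?_
    refine Fin.cases ?_ (fun k => ?_) i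
    · simpa using continuous_id'
    · simpa using continuous_const
  obtain ⟨p, ⟨hp, t, rfl⟩, -⟩ := S.existsUnique_inter (fun t => Fin.cons t x)
    ⟨hc, fun s t hst => ⟨fun h => hst.ne (by simpa using congrFun h 0), by
      have h (k : Fin 3) : (Fin.cons t x - Fin.cons s x : Spacetime) k.succ = 0 := by simp
      have h1 := h 0
      have h2 := h 1
      have h3 := h 2
      simp only [Fin.succ_zero_eq_one, Fin.succ_one_eq_two] at h1 h2
      have h3' : (Fin.cons t x - Fin.cons s x : Spacetime) 3 = 0 := h3
      rw [minkowskiSq, h1, h2, h3']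
      nlinarith [sq_nonneg ((Fin.cons t x - Fin.cons s x : Spacetime) 0)]⟩⟩
    ⟨fun ⟨q, hq⟩ => not_tendsto_nhds_of_tendsto_atTop tendsto_id (q 0)
        ((continuous_apply (0 : Fin 4)).continuousAt.tendsto.comp hq),
      fun ⟨q, hq⟩ => not_tendsto_nhds_of_tendsto_atBot tendsto_id (q 0)
        ((continuous_apply (0 : Fin 4)).continuousAt.tendsto.comp hq)⟩
  exact ⟨t, hp⟩

/-- The time coordinate `t_Σ(x)` of the unique point of `Σ` over `x ∈ ℝ³`. -/
def time (S : CauchySurface) (x : Fin 3 → ℝ) : ℝ := (S.exists_time x).choose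

/-- The global chart `x ↦ (t_Σ(x), x)` of `Σ`, as a map `ℝ³ → Σ`. -/
def graph (S : CauchySurface) (x : Fin 3 → ℝ) : S.carrier :=
  ⟨Fin.cons (S.time x) x, (S.exists_time x).choose_spec⟩

/-- The image on `Σ` of Lebesgue measure `d³x` under the global chart `x ↦ (t_Σ(x), x)`. Its null
sets are those of the surface measure. -/
def measure (S : CauchySurface) : Measure S.carrier := Measure.map S.graph volume

/-- The spatial part `ℝ³ ∋ x` of a point `(t_Σ(x), x)` of `Σ`. -/
def space (S : CauchySurface) (p : S.carrier) : Fin 3 → ℝ := Fin.tail p.1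

/-- The tangent vectors `∂ₖ(t_Σ(x), x) = (∂ₖ t_Σ(x), eₖ)` of `Σ` at `p = (t_Σ(x), x)` given by the
global chart. -/
def frame (S : CauchySurface) (p : S.carrier) (k : Fin 3) : Spacetime :=
  Fin.cons (fderiv ℝ S.time (S.space p) (Pi.single k 1)) (Pi.single k 1)

/-- The integrand of the scalar product: `φ̄ i_γ(d⁴x) ψ`, with `φ̄ = φ† γ⁰`, with respect to the chart
measure `S.measure`. -/
def density (S : CauchySurface) (p : S.carrier) (u v : Spinor) : ℂ :=
  inner ℂ u (act (gamma 0 * gammaForm (S.frame p)) v)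

/-- The slope `(∂₁ t_Σ, ∂₂ t_Σ, ∂₃ t_Σ)`. -/
def slope (S : CauchySurface) (p : S.carrier) : Fin 3 → ℝ :=
  fun k => fderiv ℝ S.time (S.space p) (Pi.single k 1)

end CauchySurface

/-- `∑ₖ wₖ γ⁰ γᵏ`. -/
def alpha (w : Fin 3 → ℝ) : Matrix (Fin 4) (Fin 4) ℂ :=
  ∑ k : Fin 3, (w k : ℂ) • (gamma 0 * gamma k.succ)

theorem alpha_eq (w : Fin 3 → ℝ) : alpha w =
    !![0, 0, (w 2 : ℂ), w 0 - Complex.I * w 1; 0, 0, w 0 + Complex.I * w 1, -w 2;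
      (w 2 : ℂ), w 0 - Complex.I * w 1, 0, 0; w 0 + Complex.I * w 1, -w 2, 0, 0] := by
  ext i j
  fin_cases i <;> fin_cases j <;>
    simp [alpha, gamma, Fin.sum_univ_succ] <;> ring

theorem alpha_sq (w : Fin 3 → ℝ) :
    alpha w * alpha w = ((w 0 ^ 2 + w 1 ^ 2 + w 2 ^ 2 : ℝ) : ℂ) • 1 := by
  rw [alpha_eq]
  ext i j
  fin_cases i <;> fin_cases j <;>
    simp [Fin.sum_univ_succ, Matrix.mul_apply] <;> ring_nf <;> simp

theorem alpha_isHermitian (w : Fin 3 → ℝ) : (alpha w).IsHermitian := by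
  rw [alpha_eq]
  ext i j
  fin_cases i <;> fin_cases j <;> simp <;> ring

theorem gammaForm_eq (w : Fin 3 → ℝ) :
    gammaForm (fun k => Fin.cons (w k) (Pi.single k 1)) =
      gamma 0 - ∑ k : Fin 3, (w k : ℂ) • gamma k.succ := by
  have h0 : Matrix.det (Matrix.of (Fin.cons (Pi.single 0 1)
      (fun k => Fin.cons (w k) (Pi.single k 1)) : Fin 4 → Spacetime)) = 1 := by
    have h : Matrix.of (Fin.cons (Pi.single 0 1)
      (fun k => Fin.cons (w k) (Pi.single k 1)) : Fin 4 → Spacetime) =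
      !![1, 0, 0, 0; w 0, 1, 0, 0; w 1, 0, 1, 0; w 2, 0, 0, 1] := by
      ext i j; fin_cases i <;> fin_cases j <;> rfl
    rw [h]
    simp [Matrix.det_succ_row_zero, Fin.sum_univ_succ, Fin.succAbove]
  have h1 : Matrix.det (Matrix.of (Fin.cons (Pi.single 1 1)
      (fun k => Fin.cons (w k) (Pi.single k 1)) : Fin 4 → Spacetime)) = -w 0 := by
    have h : Matrix.of (Fin.cons (Pi.single 1 1)
      (fun k => Fin.cons (w k) (Pi.single k 1)) : Fin 4 → Spacetime) =
      !![0, 1, 0, 0; w 0, 1, 0, 0; w 1, 0, 1, 0; w 2, 0, 0, 1] := by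
      ext i j; fin_cases i <;> fin_cases j <;> rfl
    rw [h]
    simp [Matrix.det_succ_row_zero, Fin.sum_univ_succ, Fin.succAbove]
  have h2 : Matrix.det (Matrix.of (Fin.cons (Pi.single 2 1)
      (fun k => Fin.cons (w k) (Pi.single k 1)) : Fin 4 → Spacetime)) = -w 1 := by
    have h : Matrix.of (Fin.cons (Pi.single 2 1)
      (fun k => Fin.cons (w k) (Pi.single k 1)) : Fin 4 → Spacetime) =
      !![0, 0, 1, 0; w 0, 1, 0, 0; w 1, 0, 1, 0; w 2, 0, 0, 1] := by
      ext i j; fin_cases i <;> fin_cases j <;> rfl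
    rw [h]
    simp [Matrix.det_succ_row_zero, Fin.sum_univ_succ, Fin.succAbove]
  have h3 : Matrix.det (Matrix.of (Fin.cons (Pi.single 3 1)
      (fun k => Fin.cons (w k) (Pi.single k 1)) : Fin 4 → Spacetime)) = -w 2 := by
    have h : Matrix.of (Fin.cons (Pi.single 3 1)
      (fun k => Fin.cons (w k) (Pi.single k 1)) : Fin 4 → Spacetime) =
      !![0, 0, 0, 1; w 0, 1, 0, 0; w 1, 0, 1, 0; w 2, 0, 0, 1] := by
      ext i j; fin_cases i <;> fin_cases j <;> rfl
    rw [h]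
    simp [Matrix.det_succ_row_zero, Fin.sum_univ_succ, Fin.succAbove]
    ring
  rw [gammaForm, Fin.sum_univ_four, h0, h1, h2, h3, Fin.sum_univ_three]
  have e3 : (Fin.succ 2 : Fin 4) = 3 := rfl
  simp only [Complex.ofReal_neg, Complex.ofReal_one, one_smul, neg_smul, Fin.succ_zero_eq_one,
    Fin.succ_one_eq_two, e3]
  abel

theorem gamma_mul_gammaForm (w : Fin 3 → ℝ) :
    gamma 0 * gammaForm (fun k => Fin.cons (w k) (Pi.single k 1)) = 1 - alpha w := by
  have h : gamma 0 * gamma 0 = 1 := by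
    ext i j
    fin_cases i <;> fin_cases j <;> simp [gamma]
  rw [gammaForm_eq, mul_sub, h, alpha, Finset.mul_sum]
  simp

/-- The positive square root of `1 - alpha w` for `|w| < 1`. -/
def rootA (w : Fin 3 → ℝ) : ℝ := √((1 + √(1 - (w 0 ^ 2 + w 1 ^ 2 + w 2 ^ 2))) / 2)

/-- The positive square root of `1 - alpha w` for `|w| < 1`. -/
def rootM (w : Fin 3 → ℝ) : Matrix (Fin 4) (Fin 4) ℂ :=
  (rootA w : ℂ) • 1 - (((2 * rootA w)⁻¹ : ℝ) : ℂ) • alpha w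

theorem rootM_mul_self (w : Fin 3 → ℝ) (hw : w 0 ^ 2 + w 1 ^ 2 + w 2 ^ 2 < 1) :
    rootM w * rootM w = 1 - alpha w := by
  have hs := Real.sq_sqrt (show 0 ≤ 1 - (w 0 ^ 2 + w 1 ^ 2 + w 2 ^ 2) by linarith)
  have hs0 := Real.sqrt_nonneg (1 - (w 0 ^ 2 + w 1 ^ 2 + w 2 ^ 2))
  have ha : rootA w ^ 2 = (1 + √(1 - (w 0 ^ 2 + w 1 ^ 2 + w 2 ^ 2))) / 2 :=
    Real.sq_sqrt (by positivity)
  have ha0 : 0 < rootA w := Real.sqrt_pos.2 (by positivity)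
  have h1 : rootA w * rootA w + (2 * rootA w)⁻¹ * (2 * rootA w)⁻¹ *
      (w 0 ^ 2 + w 1 ^ 2 + w 2 ^ 2) = 1 := by
    field_simp
    have : rootA w ^ 4 = ((1 + √(1 - (w 0 ^ 2 + w 1 ^ 2 + w 2 ^ 2))) / 2) ^ 2 := by
      rw [← ha]; ring
    nlinarith
  have h2 : rootA w * (2 * rootA w)⁻¹ + (2 * rootA w)⁻¹ * rootA w = 1 := by
    field_simp
    norm_num
  have e : rootM w * rootM w = (((rootA w * rootA w + (2 * rootA w)⁻¹ * (2 * rootA w)⁻¹ *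
      (w 0 ^ 2 + w 1 ^ 2 + w 2 ^ 2) : ℝ)) : ℂ) • 1 -
      (((rootA w * (2 * rootA w)⁻¹ + (2 * rootA w)⁻¹ * rootA w : ℝ)) : ℂ) • alpha w := by
    simp only [rootM, sub_mul, mul_sub, smul_mul_smul_comm, alpha_sq, mul_one, one_mul, smul_smul,
      Complex.ofReal_add, Complex.ofReal_mul, add_smul, mul_add, smul_add]
    abel
  rw [e, h1, h2]
  simp

theorem rootM_isHermitian (w : Fin 3 → ℝ) : (rootM w).IsHermitian := by
  rw [Matrix.IsHermitian, rootM, Matrix.conjTranspose_sub, Matrix.conjTranspose_smul,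
    Matrix.conjTranspose_smul, (alpha_isHermitian w).eq]
  simp [Complex.conj_ofReal]

/-- The inverse of `rootM w`. -/
def rootInv (w : Fin 3 → ℝ) : Matrix (Fin 4) (Fin 4) ℂ :=
  (((1 - (w 0 ^ 2 + w 1 ^ 2 + w 2 ^ 2))⁻¹ : ℝ) : ℂ) • ((1 + alpha w) * rootM w)

theorem rootInv_mul (w : Fin 3 → ℝ) (hw : w 0 ^ 2 + w 1 ^ 2 + w 2 ^ 2 < 1) :
    rootInv w * rootM w = 1 := by
  have h0 : 1 - (w 0 ^ 2 + w 1 ^ 2 + w 2 ^ 2) ≠ 0 := by linarith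
  rw [rootInv, smul_mul_assoc, mul_assoc, rootM_mul_self w hw]
  have : (1 + alpha w) * (1 - alpha w) =
      ((1 - (w 0 ^ 2 + w 1 ^ 2 + w 2 ^ 2) : ℝ) : ℂ) • (1 : Matrix (Fin 4) (Fin 4) ℂ) := by
    rw [Complex.ofReal_sub, sub_smul, ← alpha_sq]
    simp only [add_mul, mul_sub, mul_one, one_mul, Complex.ofReal_one, one_smul]
    abel
  rw [this, smul_smul, ← Complex.ofReal_mul, inv_mul_cancel₀ h0]
  simp

theorem rootM_mul (w : Fin 3 → ℝ) (hw : w 0 ^ 2 + w 1 ^ 2 + w 2 ^ 2 < 1) :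
    rootM w * rootInv w = 1 :=
  mul_eq_one_comm.1 (rootInv_mul w hw)

theorem act_mul (M N : Matrix (Fin 4) (Fin 4) ℂ) (u : Spinor) : act (M * N) u = act M (act N u) := by
  simp [act]

@[simp] theorem act_one (u : Spinor) : act 1 u = u := by
  simp [act]

theorem inner_act_left {M : Matrix (Fin 4) (Fin 4) ℂ} (hM : M.IsHermitian) (u v : Spinor) :
    inner ℂ (act M u) v = (inner ℂ u (act M v) : ℂ) :=
  (Matrix.isSymmetric_toEuclideanLin_iff.2 hM) u v

namespace CauchySurface

variable (S : CauchySurface)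

theorem slope_sq_lt_one (p : S.carrier) :
    S.slope p 0 ^ 2 + S.slope p 1 ^ 2 + S.slope p 2 ^ 2 < 1 := by
  by_cases hd : DifferentiableAt ℝ S.time (S.space p)
  swap
  · simp [slope, fderiv_zero_of_not_differentiableAt hd]
  by_cases h0 : S.slope p = 0
  · simp [h0]
  set x := S.space p with hx
  set w := S.slope p with hw
  have hdw : fderiv ℝ S.time x w = w 0 ^ 2 + w 1 ^ 2 + w 2 ^ 2 := by
    have : w = ∑ k, w k • (Pi.single k 1 : Fin 3 → ℝ) := by
      ext i; simp [Finset.sum_apply, Pi.single_apply]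
    conv_lhs => rw [this]
    rw [map_sum, Fin.sum_univ_three]
    simp only [map_smul, smul_eq_mul]
    change w 0 * w 0 + w 1 * w 1 + w 2 * w 2 = _
    ring
  have hl : HasDerivAt (fun s : ℝ => x + s • w) w 0 := by
    simpa using ((hasDerivAt_id (0 : ℝ)).smul_const w).const_add x
  have ht : HasDerivAt (fun s : ℝ => S.time (x + s • w)) (fderiv ℝ S.time x w) 0 := by
    have h1 : HasFDerivAt S.time (fderiv ℝ S.time x) (x + (0 : ℝ) • w) := by
      simpa using hd.hasFDerivAt
    exact h1.comp_hasDerivAt (0 : ℝ) hl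
  have hv : (Fin.cons (fderiv ℝ S.time x w) w : Spacetime) ∈
      tangentVectors S.carrier (S.graph x) := by
    refine ⟨fun s => S.graph (x + s • w), fun s => (S.graph _).2, by simp, ?_⟩
    rw [hasDerivAt_pi]
    refine Fin.cases ?_ fun k => ?_
    · simpa [graph] using ht
    · simpa [graph] using (hasDerivAt_pi.1 hl) k
  have h := S.spacelike _ (S.graph x).2 _ hv (by
    intro h
    exact h0 (by ext k; simpa using congrFun h k.succ))
  have e (a : ℝ) : minkowskiSq (Fin.cons a w) = a ^ 2 - w 0 ^ 2 - w 1 ^ 2 - w 2 ^ 2 := rfl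
  rw [e, hdw] at h
  by_contra! hge
  nlinarith

theorem density_eq (p : S.carrier) (u v : Spinor) :
    S.density p u v = inner ℂ (act (rootM (S.slope p)) u) (act (rootM (S.slope p)) v) := by
  rw [density, inner_act_left (rootM_isHermitian _), ← act_mul,
    rootM_mul_self _ (S.slope_sq_lt_one p), ← gamma_mul_gammaForm]
  rfl

theorem density_self (p : S.carrier) (u : Spinor) :
    S.density p u u = ((‖act (rootM (S.slope p)) u‖ ^ 2 : ℝ) : ℂ) := by
  rw [density_eq, inner_self_eq_norm_sq_to_K]
  simp

theorem measurable_slope (k : Fin 3) : Measurable fun p : S.carrier => S.slope p k := by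
  have h1 : Measurable S.space :=
    measurable_pi_lambda _ fun k => (measurable_pi_apply k.succ).comp measurable_subtype_coe
  exact (measurable_fderiv_apply_const ℝ S.time (Pi.single k 1)).comp h1

theorem measurable_rootA : Measurable fun p : S.carrier => rootA (S.slope p) := by
  have := S.measurable_slope
  unfold rootA
  fun_prop

theorem act_alpha_aesm {φ : S.carrier → Spinor} (hφ : AEStronglyMeasurable φ S.measure) :
    AEStronglyMeasurable (fun p => act (alpha (S.slope p)) (φ p)) S.measure := by
  have h : (fun p => act (alpha (S.slope p)) (φ p)) = fun p =>
      ∑ k : Fin 3, (S.slope p k : ℂ) • act (gamma 0 * gamma k.succ) (φ p) := by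
    funext p
    simp only [act, alpha, map_sum, map_smul, LinearMap.sum_apply, LinearMap.smul_apply]
  rw [h]
  refine Finset.aestronglyMeasurable_fun_sum _ fun k _ => AEStronglyMeasurable.fun_smul ?_ ?_
  · exact (Complex.measurable_ofReal.comp (S.measurable_slope k)).aestronglyMeasurable
  · exact (LinearMap.continuous_of_finiteDimensional (act _)).comp_aestronglyMeasurable hφ

theorem act_rootM_aesm {φ : S.carrier → Spinor} (hφ : AEStronglyMeasurable φ S.measure) :
    AEStronglyMeasurable (fun p => act (rootM (S.slope p)) (φ p)) S.measure := by
  have h : (fun p => act (rootM (S.slope p)) (φ p)) = fun p =>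
      (rootA (S.slope p) : ℂ) • φ p -
        (((2 * rootA (S.slope p))⁻¹ : ℝ) : ℂ) • act (alpha (S.slope p)) (φ p) := by
    funext p
    simp [act, rootM, Matrix.toLpLin_apply, Matrix.smul_mulVec]
  rw [h]
  refine AEStronglyMeasurable.fun_sub (AEStronglyMeasurable.fun_smul ?_ hφ)
    (AEStronglyMeasurable.fun_smul ?_ (S.act_alpha_aesm hφ))
  · exact (Complex.measurable_ofReal.comp S.measurable_rootA).aestronglyMeasurable
  · exact (Complex.measurable_ofReal.comp
      (S.measurable_rootA.const_mul 2).inv).aestronglyMeasurable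

theorem act_rootInv_aesm {φ : S.carrier → Spinor} (hφ : AEStronglyMeasurable φ S.measure) :
    AEStronglyMeasurable (fun p => act (rootInv (S.slope p)) (φ p)) S.measure := by
  have h : (fun p => act (rootInv (S.slope p)) (φ p)) = fun p =>
      (((1 - (S.slope p 0 ^ 2 + S.slope p 1 ^ 2 + S.slope p 2 ^ 2))⁻¹ : ℝ) : ℂ) •
        (act (rootM (S.slope p)) (φ p) +
          act (alpha (S.slope p)) (act (rootM (S.slope p)) (φ p))) := by
    funext p
    rw [rootInv, ← act_mul]
    simp only [act, map_smul, map_add, Matrix.add_mul, one_mul, LinearMap.smul_apply,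
      LinearMap.add_apply]
  rw [h]
  have h1 := S.act_rootM_aesm hφ
  refine AEStronglyMeasurable.fun_smul ?_ (h1.fun_add (S.act_alpha_aesm h1))
  have := S.measurable_slope
  exact (Complex.measurable_ofReal.comp (by fun_prop)).aestronglyMeasurable

theorem integrable_density_iff (φ : S.carrier → Spinor) (hφ : AEStronglyMeasurable φ S.measure) :
    Integrable (fun p => S.density p (φ p) (φ p)) S.measure ↔
      MemLp (fun p => act (rootM (S.slope p)) (φ p)) 2 S.measure := by
  simp only [density_self]
  rw [memLp_two_iff_integrable_sq_norm (S.act_rootM_aesm hφ)]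
  exact ⟨fun h => by
    have := h.re
    simpa only [RCLike.re_to_complex, Complex.ofReal_re] using this, fun h => h.ofReal⟩

/-- The one-particle space `𝓗_Σ = L²(Σ, ℂ⁴)`: measurable spinor-valued functions on `Σ` modulo
null sets with finite `⟪φ, φ⟫ = ∫_Σ φ̄ i_γ(d⁴x) φ`. -/
def oneParticle : Submodule ℂ (S.carrier →ₘ[S.measure] Spinor) where
  carrier := {φ | Integrable (fun p => S.density p (φ p) (φ p)) S.measure}
  zero_mem' := by
    rw [Set.mem_ofPred_eq, S.integrable_density_iff _ (AEEqFun.aestronglyMeasurable _)]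
    refine MemLp.ae_eq ?_ (MemLp.zero (p := 2))
    filter_upwards [AEEqFun.coeFn_zero (α := S.carrier) (β := Spinor) (μ := S.measure)] with p hp
    simp [hp]
  add_mem' {φ ψ} hφ hψ := by
    rw [Set.mem_ofPred_eq, S.integrable_density_iff _ (AEEqFun.aestronglyMeasurable _)] at *
    refine MemLp.ae_eq ?_ (hφ.add hψ)
    filter_upwards [AEEqFun.coeFn_add φ ψ] with p hp
    simp [hp]
  smul_mem' c φ hφ := by
    rw [Set.mem_ofPred_eq, S.integrable_density_iff _ (AEEqFun.aestronglyMeasurable _)] at *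
    refine MemLp.ae_eq ?_ (hφ.const_smul c)
    filter_upwards [AEEqFun.coeFn_smul c φ] with p hp
    simp [hp]

end CauchySurface

/-- The Hilbert space `𝓗_Σ`. -/
abbrev HSpace (S : CauchySurface) : Type := S.oneParticle

namespace HSpace

variable {S : CauchySurface}

theorem memLp (φ : HSpace S) :
    MemLp (fun p => act (rootM (S.slope p)) ((φ : S.carrier →ₘ[S.measure] Spinor) p)) 2
      S.measure :=
  (S.integrable_density_iff _ (AEEqFun.aestronglyMeasurable _)).1 φ.2

/-- Pointwise multiplication by the square root of the density, identifying `𝓗_Σ` with an ordinary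
`L²` space. -/
def toL2 : HSpace S →ₗ[ℂ] Lp Spinor 2 S.measure where
  toFun φ := φ.memLp.toLp _
  map_add' φ ψ := by
    rw [← MemLp.toLp_add, MemLp.toLp_eq_toLp_iff]
    filter_upwards [AEEqFun.coeFn_add (φ : S.carrier →ₘ[S.measure] Spinor) ψ] with p hp
    simp [hp]
  map_smul' c φ := by
    rw [RingHom.id_apply, ← MemLp.toLp_const_smul, MemLp.toLp_eq_toLp_iff]
    filter_upwards [AEEqFun.coeFn_smul c (φ : S.carrier →ₘ[S.measure] Spinor)] with p hp
    simp [hp]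

theorem coe_toL2 (φ : HSpace S) : toL2 φ =ᵐ[S.measure]
    fun p => act (rootM (S.slope p)) ((φ : S.carrier →ₘ[S.measure] Spinor) p) :=
  φ.memLp.coeFn_toLp

theorem inner_toL2 (φ ψ : HSpace S) : inner ℂ (toL2 φ) (toL2 ψ) =
    ∫ p, S.density p ((φ : S.carrier →ₘ[S.measure] Spinor) p)
      ((ψ : S.carrier →ₘ[S.measure] Spinor) p) ∂S.measure := by
  rw [L2.inner_def]
  refine integral_congr_ae ?_
  filter_upwards [coe_toL2 φ, coe_toL2 ψ] with p h1 h2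
  rw [h1, h2, S.density_eq]

theorem toL2_injective : Function.Injective (toL2 (S := S)) := by
  rw [injective_iff_map_eq_zero]
  intro φ h
  ext1
  refine AEEqFun.ext ?_
  have h1 := coe_toL2 φ
  rw [h] at h1
  filter_upwards [h1, Lp.coeFn_zero Spinor 2 S.measure,
    AEEqFun.coeFn_zero (α := S.carrier) (β := Spinor) (μ := S.measure)] with p h2 h3 h4
  rw [h3] at h2
  have h5 := congrArg (act (rootInv (S.slope p))) h2
  rw [← act_mul, rootInv_mul _ (S.slope_sq_lt_one p), act_one] at h5
  simpa [h4] using h5.symm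

theorem toL2_surjective : Function.Surjective (toL2 (S := S)) := by
  intro g
  have hm := S.act_rootInv_aesm (Lp.aestronglyMeasurable g)
  have hr : (fun p => act (rootM (S.slope p)) ((AEEqFun.mk _ hm : S.carrier →ₘ[S.measure] Spinor) p))
      =ᵐ[S.measure] g := by
    filter_upwards [AEEqFun.coeFn_mk _ hm] with p hp
    rw [hp, ← act_mul, rootM_mul _ (S.slope_sq_lt_one p), act_one]
  refine ⟨⟨AEEqFun.mk _ hm, ?_⟩, ?_⟩
  · change Integrable _ _
    rw [S.integrable_density_iff _ (AEEqFun.aestronglyMeasurable _)]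
    exact (Lp.memLp g).ae_eq hr.symm
  · exact Lp.ext ((coe_toL2 _).trans hr)

/-- The scalar product `⟪φ, ψ⟫ = ∫_Σ φ̄ i_γ(d⁴x) ψ`. -/
@[reducible] def core : InnerProductSpace.Core ℂ (HSpace S) where
  inner φ ψ := ∫ p, S.density p ((φ : S.carrier →ₘ[S.measure] Spinor) p)
    ((ψ : S.carrier →ₘ[S.measure] Spinor) p) ∂S.measure
  conj_inner_symm φ ψ := by
    rw [← inner_toL2, ← inner_toL2, inner_conj_symm]
  re_inner_nonneg φ := by
    rw [← inner_toL2]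
    exact inner_self_nonneg
  add_left φ ψ χ := by
    simp only [← inner_toL2, map_add, inner_add_left]
  smul_left φ ψ c := by
    simp only [← inner_toL2, map_smul, inner_smul_left]
  definite φ h := by
    rw [← inner_toL2, inner_self_eq_zero] at h
    exact toL2_injective (h.trans (map_zero _).symm)

instance : NormedAddCommGroup (HSpace S) :=
  InnerProductSpace.Core.toNormedAddCommGroup (cd := core (S := S))

instance : InnerProductSpace ℂ (HSpace S) := InnerProductSpace.ofCore core.toCore

/-- `toL2` as a unitary map. -/
def l2Equiv : HSpace S ≃ₗᵢ[ℂ] Lp Spinor 2 S.measure :=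
  (LinearEquiv.ofBijective toL2 ⟨toL2_injective, toL2_surjective⟩).isometryOfInner
    fun φ ψ => inner_toL2 φ ψ

instance : CompleteSpace (HSpace S) :=
  (IsUniformInducing.completeSpace_congr l2Equiv.isometry.isUniformInducing
    l2Equiv.surjective).2 inferInstance

end HSpace

/-! ### The Dirac equation and its evolution between Cauchy surfaces -/

/-- The partial derivative `∂_μ ψ`. -/
def pderiv (ψ : Spacetime → Spinor) (μ : Fin 4) (x : Spacetime) : Spinor :=
  fderiv ℝ ψ x (Pi.single μ 1)

/-- `ψ` is a smooth solution of `(i γ^μ ∂_μ - m) ψ = e γ^μ A_μ ψ`, where `A x μ` stands for the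
covariant component `A_μ(x)` of the four-vector potential. -/
def IsDiracSolution (m e : ℝ) (A : Spacetime → Fin 4 → ℝ) (ψ : Spacetime → Spinor) : Prop :=
  ContDiff ℝ ∞ ψ ∧ ∀ x, Complex.I • ∑ μ, act (gamma μ) (pderiv ψ μ x) - (m : ℂ) • ψ x =
    (e : ℂ) • ∑ μ, (A x μ : ℂ) • act (gamma μ) (ψ x)

/-- The union of the closed forward and backward light cones with apex in `K`. -/
def lightCone (K : Set Spacetime) : Set Spacetime :=
  {x | ∃ y ∈ K, 0 ≤ minkowskiSq (x - y)}

/-- The restriction of a spinor field to a Cauchy surface. -/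
def CauchySurface.restrict (S : CauchySurface) (ψ : Spacetime → Spinor) : S.carrier → Spinor :=
  fun p => ψ p

/-- The unitary map `U : 𝓗_Σ → 𝓗_Σ'` is the one-particle Dirac evolution `U^A_{Σ'Σ}`: it maps
`ψ|_Σ` to `ψ|_Σ'` for every smooth solution `ψ` of the Dirac equation with compactly supported
initial datum `ψ|_Σ` which is supported in the forward and backward light cone of the support of
that datum. (These solutions realize every datum in `C_c^∞(Σ, ℂ⁴)`, exactly once, and such data are
dense in `𝓗_Σ`, so that this determines `U`.) -/
def IsDiracEvolution (m e : ℝ) (A : Spacetime → Fin 4 → ℝ) (S S' : CauchySurface)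
    (U : HSpace S ≃ₗᵢ[ℂ] HSpace S') : Prop :=
  ∀ ψ : Spacetime → Spinor, IsDiracSolution m e A ψ → HasCompactSupport (S.restrict ψ) →
    Function.support ψ ⊆ lightCone (Subtype.val '' tsupport (S.restrict ψ)) →
    ∀ φ : HSpace S, (φ : S.carrier →ₘ[S.measure] Spinor) =ᵐ[S.measure] S.restrict ψ →
      (U φ : S'.carrier →ₘ[S'.measure] Spinor) =ᵐ[S'.measure] S'.restrict ψ

end DiracSea

end

/-!
The equivalence holds for every unitary one-particle map `U`; it is the theorem of Shale and
Stinespring. Pulling `V'` back along `U`, one has to compare two polarizations `V` and `Q` of one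
Hilbert space `H`. A representation of the anticommutation relations is a linear family `ψ f` of
creation operators (`IsCAR`); a vacuum for `V` is a vector annihilated by `ψ f` for `f ∈ V` and by
`(ψ f)†` for `f ∈ Vᗮ` (`IsVacuum`); the Fock space of `V` carries a representation with a cyclic
vacuum for `V` (`FockSpace.isFock_field`). The argument then uses only this structure.

A unitary equivalence turns the vacuum of `Q` into a vacuum `Φ` for `Q` in the Fock space of `V`.
Let `eᵢ = qᵢ + rᵢ` be a finite orthonormal family in `V`, decomposed along `Q` and `Qᗮ`. The number
of particles in these modes has expectation `μ = ∑ ‖rᵢ‖²` in the state `Φ`, and the fluctuation is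
the two-particle vector `∑ (ψ qᵢ)† ψ rᵢ Φ`, of norm at most `√μ ‖Φ‖`
(`IsCAR.norm_numberOp_sub_sq_le`). On the dense set of vectors generated from the Fock vacuum by
finitely many operators the particle number is bounded uniformly in the family. A vector of
this set which is not orthogonal to `Φ` yields `μ ≤ O(√μ) + O(1)`, a bound for `μ`
(`IsCyclic.exists_bound`). This says that `P^{Qᗮ} P^V` is Hilbert–Schmidt; the same estimate for
the dual representation `f ↦ (ψ f)†` of the complex conjugate space treats `P^Q P^{Vᗮ}`.

Conversely, let both operators be Hilbert–Schmidt. Then the Fock vacuum `Ω` of `V` has a finite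
expected number of particles with respect to `Q`, and all but finitely many modes contribute less
than one. For these the projections of `Ω` to the joint vacua of finite subfamilies are
bounded below, hence a joint vacuum of all of them exists; the finitely many remaining modes are
emptied by their annihilation operators (`IsModeFamily.exists_vacuum`). So each of the two Fock
spaces contains a vacuum for the other polarization. The scalar products of the states created from
a vacuum are determined by the anticommutation relations (`inner_fockVec`), so that such a vacuum
gives an isometric intertwiner from one Fock space to the other; it is onto since its range contains
a vacuum of the target polarization and this is unique up to a factor (`IsFock.exists_unitary`).
-/

noncomputable section

open scoped InnerProduct

namespace DiracSea

/-! ### Representations of the canonical anticommutation relations -/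

section CAR

variable {H F : Type*} [NormedAddCommGroup H] [InnerProductSpace ℂ H]
  [NormedAddCommGroup F] [InnerProductSpace ℂ F] [CompleteSpace F]

/-- The canonical anticommutation relations `{ψ f, ψ g} = 0` and `{(ψ f)†, ψ g} = ⟪f, g⟫` for a
family of bounded operators which depends linearly on `f`. -/
structure IsCAR (ψ : H →ₗ[ℂ] F →L[ℂ] F) : Prop where
  anticomm (f g : H) (x : F) : ψ f (ψ g x) = -ψ g (ψ f x)
  adjoint_apply (f g : H) (x : F) : ((ψ f)†) (ψ g x) = (inner ℂ f g : ℂ) • x - ψ g (((ψ f)†) x)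

namespace IsCAR

variable {ψ : H →ₗ[ℂ] F →L[ℂ] F}

theorem self_apply (hψ : IsCAR ψ) (f : H) (x : F) : ψ f (ψ f x) = 0 := by
  have h := hψ.anticomm f f x
  rw [eq_neg_iff_add_eq_zero, ← two_smul ℂ] at h
  simpa using h

theorem apply_adjoint (hψ : IsCAR ψ) (f g : H) (x : F) :
    ψ f (((ψ g)†) x) = (inner ℂ g f : ℂ) • x - ((ψ g)†) (ψ f x) := by
  rw [hψ.adjoint_apply]
  abel

theorem adjoint_anticomm (hψ : IsCAR ψ) (f g : H) (x : F) :
    ((ψ f)†) (((ψ g)†) x) = -((ψ g)†) (((ψ f)†) x) := by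
  refine ext_inner_left ℂ fun y => ?_
  rw [inner_neg_right]
  simp only [ContinuousLinearMap.adjoint_inner_right]
  rw [hψ.anticomm, inner_neg_left]

theorem norm_sq_add_norm_sq (hψ : IsCAR ψ) (f : H) (x : F) :
    ‖ψ f x‖ ^ 2 + ‖((ψ f)†) x‖ ^ 2 = ‖f‖ ^ 2 * ‖x‖ ^ 2 := by
  have h1 : (inner ℂ (ψ f x) (ψ f x) : ℂ) + inner ℂ (((ψ f)†) x) (((ψ f)†) x) =
      inner ℂ f f * inner ℂ x x := by
    rw [ContinuousLinearMap.adjoint_inner_left, hψ.apply_adjoint,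
      ← ContinuousLinearMap.adjoint_inner_right, inner_sub_right, inner_smul_right]
    ring
  simp only [inner_self_eq_norm_sq_to_K] at h1
  exact_mod_cast h1

theorem norm_apply_le (hψ : IsCAR ψ) (f : H) (x : F) : ‖ψ f x‖ ≤ ‖f‖ * ‖x‖ := by
  refine le_of_sq_le_sq ?_ (by positivity)
  nlinarith [hψ.norm_sq_add_norm_sq f x, sq_nonneg ‖((ψ f)†) x‖]

theorem norm_adjoint_apply_le (hψ : IsCAR ψ) (f : H) (x : F) : ‖((ψ f)†) x‖ ≤ ‖f‖ * ‖x‖ := by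
  refine le_of_sq_le_sq ?_ (by positivity)
  nlinarith [hψ.norm_sq_add_norm_sq f x, sq_nonneg ‖ψ f x‖]

end IsCAR

/-- Exchange of creation and annihilation: the family `f ↦ (ψ f)†`, which depends linearly on `f`
as an element of the complex conjugate space. -/
def dualField (ψ : H →ₗ[ℂ] F →L[ℂ] F) : ConjSpace H →ₗ[ℂ] F →L[ℂ] F where
  toFun f := (ψ (ConjSpace.of.symm f))†
  map_add' f g := by simp
  map_smul' c f := by
    have : ConjSpace.of.symm (c • f) = conj c • ConjSpace.of.symm f := rfl
    rw [this, map_smul, LinearIsometryEquiv.map_smulₛₗ]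
    simp

theorem dualField_of (ψ : H →ₗ[ℂ] F →L[ℂ] F) (f : H) : dualField ψ (ConjSpace.of f) = (ψ f)† :=
  rfl

theorem IsCAR.dualField {ψ : H →ₗ[ℂ] F →L[ℂ] F} (hψ : IsCAR ψ) : IsCAR (dualField ψ) where
  anticomm f g x := hψ.adjoint_anticomm _ _ x
  adjoint_apply f g x := by
    change (((ψ (ConjSpace.of.symm f))†)†) _ =
      inner ℂ (ConjSpace.of.symm g) (ConjSpace.of.symm f) • x -
        ((ψ (ConjSpace.of.symm g))†) ((((ψ (ConjSpace.of.symm f))†)†) x)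
    rw [ContinuousLinearMap.adjoint_adjoint]
    exact hψ.apply_adjoint _ _ x

theorem IsCAR.comp {ψ : H →ₗ[ℂ] F →L[ℂ] F} (hψ : IsCAR ψ) {K : Type*} [NormedAddCommGroup K]
    [InnerProductSpace ℂ K] (i : K →ₗᵢ[ℂ] H) : IsCAR (ψ ∘ₗ i.toLinearMap) where
  anticomm f g x := hψ.anticomm _ _ x
  adjoint_apply f g x := by
    rw [← i.inner_map_map]
    exact hψ.adjoint_apply _ _ x

/-- `Φ` is a vacuum for `V`: all states in `V` are occupied, all states in `Vᗮ` are empty. -/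
structure IsVacuum (ψ : H →ₗ[ℂ] F →L[ℂ] F) (V : Submodule ℂ H) (Φ : F) : Prop where
  apply_eq_zero (f : H) (hf : f ∈ V) : ψ f Φ = 0
  adjoint_apply_eq_zero (f : H) (hf : f ∈ Vᗮ) : ((ψ f)†) Φ = 0

theorem IsVacuum.smul {ψ : H →ₗ[ℂ] F →L[ℂ] F} {V : Submodule ℂ H} {Φ : F}
    (hΦ : IsVacuum ψ V Φ) (c : ℂ) : IsVacuum ψ V (c • Φ) :=
  ⟨fun f hf => by rw [map_smul, hΦ.apply_eq_zero f hf, smul_zero],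
    fun f hf => by rw [map_smul, hΦ.adjoint_apply_eq_zero f hf, smul_zero]⟩

/-- No proper closed subspace which contains `Ω` is invariant under the operators `ψ f` and
`(ψ f)†`. -/
def IsCyclic (ψ : H →ₗ[ℂ] F →L[ℂ] F) (Ω : F) : Prop :=
  ∀ R : Submodule ℂ F, IsClosed (R : Set F) → Ω ∈ R → (∀ f, ∀ x ∈ R, ψ f x ∈ R) →
    (∀ f, ∀ x ∈ R, ((ψ f)†) x ∈ R) → R = ⊤

theorem IsCyclic.topologicalClosure_eq_top {ψ : H →ₗ[ℂ] F →L[ℂ] F} {Ω : F} (h : IsCyclic ψ Ω)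
    {R : Submodule ℂ F} (h0 : Ω ∈ R) (h1 : ∀ f, ∀ x ∈ R, ψ f x ∈ R)
    (h2 : ∀ f, ∀ x ∈ R, ((ψ f)†) x ∈ R) : R.topologicalClosure = ⊤ := by
  have key (A : F →L[ℂ] F) (hA : ∀ x ∈ R, A x ∈ R) (x : F) (hx : x ∈ R.topologicalClosure) :
      A x ∈ R.topologicalClosure := by
    rw [← SetLike.mem_coe, Submodule.topologicalClosure_coe] at hx ⊢
    exact map_mem_closure A.continuous hx hA
  exact h _ R.isClosed_topologicalClosure (R.le_topologicalClosure h0)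
    (fun f => key _ (h1 f)) (fun f => key _ (h2 f))

theorem IsCyclic.dualField {ψ : H →ₗ[ℂ] F →L[ℂ] F} {Ω : F} (h : IsCyclic ψ Ω) :
    IsCyclic (dualField ψ) Ω := by
  intro R hR h0 h1 h2
  refine h R hR h0 (fun f x hx => ?_) fun f x hx => h1 (ConjSpace.of f) x hx
  have := h2 (ConjSpace.of f) x hx
  rwa [dualField_of, ContinuousLinearMap.adjoint_adjoint] at this

/-- A Fock representation of the anticommutation relations, with polarization `V` and vacuum
vector `Ω`. -/
structure IsFock (ψ : H →ₗ[ℂ] F →L[ℂ] F) (V : Submodule ℂ H) (Ω : F) : Prop where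
  isCAR : IsCAR ψ
  norm_eq_one : ‖Ω‖ = 1
  isVacuum : IsVacuum ψ V Ω
  isCyclic : IsCyclic ψ Ω

end CAR

/-! ### Two-particle estimate: finiteness of the expected particle number -/

section Number

variable {H F : Type*} [NormedAddCommGroup H] [InnerProductSpace ℂ H]
  [NormedAddCommGroup F] [InnerProductSpace ℂ F] [CompleteSpace F]
  {ψ : H →ₗ[ℂ] F →L[ℂ] F}

theorem norm_sum_inner_smul_le {ι : Type*} [Fintype ι] {e : ι → H} (he : Orthonormal ℂ e) (f : H) :
    ‖∑ i, (inner ℂ (e i) f : ℂ) • e i‖ ≤ ‖f‖ := by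
  refine le_of_sq_le_sq ?_ (norm_nonneg _)
  have h : ‖∑ i, (inner ℂ (e i) f : ℂ) • e i‖ ^ 2 = ∑ i, ‖(inner ℂ (e i) f : ℂ)‖ ^ 2 := by
    have h1 := he.inner_sum (fun i => (inner ℂ (e i) f : ℂ)) (fun i => (inner ℂ (e i) f : ℂ))
      Finset.univ
    rw [inner_self_eq_norm_sq_to_K] at h1
    simp only [RCLike.conj_mul] at h1
    exact_mod_cast h1
  rw [h]
  exact he.sum_inner_products_le f

/-- The number operator `∑ᵢ (ψ eᵢ)† ψ eᵢ` of a finite family of modes. -/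
def numberOp (ψ : H →ₗ[ℂ] F →L[ℂ] F) {n : ℕ} (e : Fin n → H) (x : F) : F :=
  ∑ i, ((ψ (e i))†) (ψ (e i) x)

theorem IsCAR.numberOp_apply (hψ : IsCAR ψ) {n : ℕ} (e : Fin n → H) (f : H) (x : F) :
    numberOp ψ e (ψ f x) =
      ψ f (numberOp ψ e x) - ψ (∑ i, (inner ℂ (e i) f : ℂ) • e i) x := by
  simp only [numberOp, map_sum, map_smul, sum_apply,
    smul_apply]
  rw [← Finset.sum_sub_distrib]
  refine Finset.sum_congr rfl fun i _ => ?_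
  rw [hψ.anticomm, map_neg, hψ.adjoint_apply]
  abel

theorem IsCAR.numberOp_adjoint_apply (hψ : IsCAR ψ) {n : ℕ} (e : Fin n → H) (f : H) (x : F) :
    numberOp ψ e (((ψ f)†) x) =
      ((ψ f)†) (numberOp ψ e x) + ((ψ (∑ i, (inner ℂ (e i) f : ℂ) • e i))†) x := by
  simp only [numberOp, map_sum, map_smul, sum_apply,
    smul_apply, LinearIsometryEquiv.map_smulₛₗ]
  rw [← Finset.sum_add_distrib]
  refine Finset.sum_congr rfl fun i _ => ?_
  rw [hψ.apply_adjoint, map_sub, hψ.adjoint_anticomm, inner_conj_symm, map_smul]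
  abel

theorem inner_numberOp (ψ : H →ₗ[ℂ] F →L[ℂ] F) {n : ℕ} (e : Fin n → H) (x y : F) :
    (inner ℂ (numberOp ψ e x) y : ℂ) = inner ℂ x (numberOp ψ e y) := by
  simp only [numberOp, sum_inner, inner_sum, ContinuousLinearMap.adjoint_inner_left,
    ContinuousLinearMap.adjoint_inner_right]

/-- The states obtained from `Ω` by finitely many creation and annihilation operators contain a
bounded number of the particles which are absent from `Ω`, uniformly in the finite family of modes
which is inspected. -/
def finiteNumber (ψ : H →ₗ[ℂ] F →L[ℂ] F) (Ω : F) : Submodule ℂ F where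
  carrier := {x | ∃ C : ℝ, ∀ (n : ℕ) (e : Fin n → H), Orthonormal ℂ e → (∀ i, ψ (e i) Ω = 0) →
    ‖numberOp ψ e x‖ ≤ C}
  zero_mem' := ⟨0, fun n e _ _ => by simp [numberOp]⟩
  add_mem' := by
    rintro x y ⟨C, hC⟩ ⟨D, hD⟩
    refine ⟨C + D, fun n e he h0 => ?_⟩
    have : numberOp ψ e (x + y) = numberOp ψ e x + numberOp ψ e y := by
      simp [numberOp, Finset.sum_add_distrib]
    rw [this]
    exact (norm_add_le _ _).trans (add_le_add (hC n e he h0) (hD n e he h0))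
  smul_mem' := by
    rintro c x ⟨C, hC⟩
    refine ⟨‖c‖ * C, fun n e he h0 => ?_⟩
    have : numberOp ψ e (c • x) = c • numberOp ψ e x := by
      simp [numberOp, Finset.smul_sum]
    rw [this, norm_smul]
    exact mul_le_mul_of_nonneg_left (hC n e he h0) (norm_nonneg _)

theorem IsCyclic.finiteNumber_dense {Ω : F} (hΩ : IsCyclic ψ Ω) (hψ : IsCAR ψ) :
    (finiteNumber ψ Ω).topologicalClosure = ⊤ := by
  refine hΩ.topologicalClosure_eq_top ⟨0, fun n e _ h0 => by simp [numberOp, h0]⟩ ?_ ?_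
  · rintro f x ⟨C, hC⟩
    refine ⟨‖f‖ * C + ‖f‖ * ‖x‖, fun n e he h0 => ?_⟩
    rw [hψ.numberOp_apply]
    refine (norm_sub_le _ _).trans (add_le_add ((hψ.norm_apply_le _ _).trans ?_)
      ((hψ.norm_apply_le _ _).trans ?_))
    · exact mul_le_mul_of_nonneg_left (hC n e he h0) (norm_nonneg _)
    · exact mul_le_mul_of_nonneg_right (norm_sum_inner_smul_le he f) (norm_nonneg _)
  · rintro f x ⟨C, hC⟩
    refine ⟨‖f‖ * C + ‖f‖ * ‖x‖, fun n e he h0 => ?_⟩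
    rw [hψ.numberOp_adjoint_apply]
    refine (norm_add_le _ _).trans (add_le_add ((hψ.norm_adjoint_apply_le _ _).trans ?_)
      ((hψ.norm_adjoint_apply_le _ _).trans ?_))
    · exact mul_le_mul_of_nonneg_left (hC n e he h0) (norm_nonneg _)
    · exact mul_le_mul_of_nonneg_right (norm_sum_inner_smul_le he f) (norm_nonneg _)

/-- The particle number in the modes `eᵢ = qᵢ + rᵢ` has expectation `∑ᵢ ‖rᵢ‖²` in a state `Φ` with
`ψ qᵢ Φ = 0 = (ψ rᵢ)† Φ`; the deviation from it is the two-particle component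
`∑ᵢ (ψ qᵢ)† ψ rᵢ Φ`, so that the variance is at most the expectation. -/
theorem IsCAR.norm_numberOp_sub_sq_le (hψ : IsCAR ψ) {n : ℕ} {e q r : Fin n → H}
    (he : Orthonormal ℂ e) (h : ∀ i, e i = q i + r i) (hqr : ∀ i j, (inner ℂ (q i) (r j) : ℂ) = 0)
    {Φ : F} (hq : ∀ i, ψ (q i) Φ = 0) (hr : ∀ i, ((ψ (r i))†) Φ = 0) :
    ‖numberOp ψ e Φ - ((∑ i, ‖r i‖ ^ 2 : ℝ) : ℂ) • Φ‖ ^ 2 ≤ (∑ i, ‖r i‖ ^ 2) * ‖Φ‖ ^ 2 := by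
  have hrq (i j) : (inner ℂ (r i) (q j) : ℂ) = 0 := by rw [← inner_conj_symm, hqr, map_zero]
  have h1 : numberOp ψ e Φ - ((∑ i, ‖r i‖ ^ 2 : ℝ) : ℂ) • Φ =
      ∑ i, ((ψ (q i))†) (ψ (r i) Φ) := by
    rw [numberOp, Complex.ofReal_sum, Finset.sum_smul, ← Finset.sum_sub_distrib]
    refine Finset.sum_congr rfl fun i _ => ?_
    rw [h i, map_add, map_add, add_apply, add_apply, hq,
      zero_add, hψ.adjoint_apply (r i) (r i), hr, map_zero, inner_self_eq_norm_sq_to_K]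
    simp
  have hqq (i j) : (inner ℂ (q i) (q j) : ℂ) = (if i = j then 1 else 0) - inner ℂ (r i) (r j) := by
    rw [← orthonormal_iff_ite.1 he i j, h i, h j]
    simp [inner_add_left, inner_add_right, hqr, hrq]
  have h2 (i j) : (inner ℂ (((ψ (q i))†) (ψ (r i) Φ)) (((ψ (q j))†) (ψ (r j) Φ)) : ℂ) =
      ((if i = j then ((‖r i‖ ^ 2 : ℝ) : ℂ) else 0) - ((‖(inner ℂ (r i) (r j) : ℂ)‖ ^ 2 : ℝ) : ℂ)) *
        ((‖Φ‖ ^ 2 : ℝ) : ℂ) := by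
    rw [ContinuousLinearMap.adjoint_inner_left, hψ.apply_adjoint, hψ.anticomm (q i) (r j), hq,
      map_zero, neg_zero, map_zero, sub_zero, inner_smul_right,
      ← ContinuousLinearMap.adjoint_inner_right, hψ.adjoint_apply, hr, map_zero, sub_zero,
      inner_smul_right, inner_self_eq_norm_sq_to_K, hqq, ← mul_assoc, sub_mul, ← inner_conj_symm,
      RCLike.mul_conj, RCLike.norm_conj]
    by_cases hij : i = j
    · subst hij
      simp
    · simp [hij, Ne.symm hij]
  have h3 : (((‖∑ i, ((ψ (q i))†) (ψ (r i) Φ)‖ ^ 2 : ℝ)) : ℂ) =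
      (((∑ i, ‖r i‖ ^ 2 - ∑ i, ∑ j, ‖(inner ℂ (r i) (r j) : ℂ)‖ ^ 2) * ‖Φ‖ ^ 2 : ℝ) : ℂ) := by
    have := inner_self_eq_norm_sq_to_K (𝕜 := ℂ) (∑ i, ((ψ (q i))†) (ψ (r i) Φ))
    rw [Complex.ofReal_pow]
    refine this.symm.trans ?_
    simp only [sum_inner, inner_sum, h2]
    simp only [← Finset.sum_mul, Finset.sum_sub_distrib]
    simp only [Finset.sum_ite_eq', Finset.mem_univ, if_true]
    rw [Finset.sum_comm (f := fun i j => ((‖(inner ℂ (r j) (r i) : ℂ)‖ ^ 2 : ℝ) : ℂ))]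
    simp
  rw [h1, Complex.ofReal_injective h3]
  refine mul_le_mul_of_nonneg_right ?_ (by positivity)
  exact sub_le_self _ (by positivity)

/-- If `ψ eᵢ Ω = 0` for a cyclic vector `Ω`, the expected numbers of particles in the modes `eᵢ` in
the state `Φ` are bounded: otherwise the particle number would be large, up to fluctuations of
lower order, on every state not orthogonal to `Φ`. -/
theorem IsCyclic.exists_bound {Ω Φ : F} (hΩ : IsCyclic ψ Ω) (hψ : IsCAR ψ) (hΦ : Φ ≠ 0) :
    ∃ C : ℝ, ∀ (n : ℕ) (e q r : Fin n → H), Orthonormal ℂ e → (∀ i, ψ (e i) Ω = 0) →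
      (∀ i, e i = q i + r i) → (∀ i j, (inner ℂ (q i) (r j) : ℂ) = 0) → (∀ i, ψ (q i) Φ = 0) →
      (∀ i, ((ψ (r i))†) Φ = 0) → ∑ i, ‖r i‖ ^ 2 ≤ C := by
  obtain ⟨Ψ, ⟨C, hC⟩, hΨ⟩ : ∃ Ψ ∈ finiteNumber ψ Ω, (inner ℂ Ψ Φ : ℂ) ≠ 0 := by
    by_contra! h
    have h1 : Φ ∈ (finiteNumber ψ Ω)ᗮ := (Submodule.mem_orthogonal _ _).2 h
    rw [Submodule.topologicalClosure_eq_top_iff.1 (hΩ.finiteNumber_dense hψ)] at h1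
    exact hΦ h1
  have ha : 0 < ‖(inner ℂ Ψ Φ : ℂ)‖ := norm_pos_iff.2 hΨ
  refine ⟨1 + ((‖Ψ‖ * ‖Φ‖ + |C| * ‖Φ‖) / ‖(inner ℂ Ψ Φ : ℂ)‖) ^ 2,
    fun n e q r he h0 h hqr hq hr => ?_⟩
  have h1 := hψ.norm_numberOp_sub_sq_le he h hqr hq hr
  have h2 := hC n e he h0
  set μ := ∑ i, ‖r i‖ ^ 2 with hμ
  have hμ0 : 0 ≤ μ := by positivity
  have h3 : ‖numberOp ψ e Φ - (μ : ℂ) • Φ‖ ≤ √μ * ‖Φ‖ := by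
    refine le_of_sq_le_sq ?_ (by positivity)
    rwa [mul_pow, Real.sq_sqrt hμ0]
  have h4 : (μ : ℂ) * inner ℂ Ψ Φ =
      inner ℂ (numberOp ψ e Ψ) Φ - inner ℂ Ψ (numberOp ψ e Φ - (μ : ℂ) • Φ) := by
    rw [inner_numberOp, inner_sub_right, inner_smul_right]
    ring
  have h5 : μ * ‖(inner ℂ Ψ Φ : ℂ)‖ ≤ |C| * ‖Φ‖ + ‖Ψ‖ * (√μ * ‖Φ‖) := by
    have := congrArg norm h4
    rw [norm_mul, Complex.norm_real, Real.norm_of_nonneg hμ0] at this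
    rw [this]
    refine (norm_sub_le _ _).trans (add_le_add ((norm_inner_le_norm _ _).trans ?_)
      ((norm_inner_le_norm _ _).trans ?_))
    · exact mul_le_mul_of_nonneg_right (h2.trans (le_abs_self C)) (norm_nonneg _)
    · exact mul_le_mul_of_nonneg_left h3 (norm_nonneg _)
  -- For `1 ≤ μ` the constant term of `h5` is absorbed into the one of order `√μ`.
  rcases le_total μ 1 with h6 | h6
  · exact h6.trans (le_add_of_nonneg_right (by positivity))
  · have h7 : 1 ≤ √μ := Real.one_le_sqrt.2 h6
    have h8 : √μ ≤ (‖Ψ‖ * ‖Φ‖ + |C| * ‖Φ‖) / ‖(inner ℂ Ψ Φ : ℂ)‖ := by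
      rw [le_div_iff₀ ha]
      refine le_of_mul_le_mul_left ?_ (zero_lt_one.trans_le h7)
      have h9 : |C| * ‖Φ‖ ≤ √μ * (|C| * ‖Φ‖) := le_mul_of_one_le_left (by positivity) h7
      calc √μ * (√μ * ‖(inner ℂ Ψ Φ : ℂ)‖) = μ * ‖(inner ℂ Ψ Φ : ℂ)‖ := by
            rw [← mul_assoc, Real.mul_self_sqrt hμ0]
        _ ≤ √μ * (‖Ψ‖ * ‖Φ‖ + |C| * ‖Φ‖) := by linarith
    calc μ = √μ ^ 2 := (Real.sq_sqrt hμ0).symm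
      _ ≤ ((‖Ψ‖ * ‖Φ‖ + |C| * ‖Φ‖) / ‖(inner ℂ Ψ Φ : ℂ)‖) ^ 2 := by gcongr
      _ ≤ _ := by linarith

end Number

/-! ### Existence of a joint vacuum of infinitely many modes -/

section Modes

variable {F ι : Type*} [NormedAddCommGroup F] [InnerProductSpace ℂ F] [CompleteSpace F]

/-- Annihilation operators of a family of independent fermionic modes. -/
structure IsModeFamily (A : ι → F →L[ℂ] F) : Prop where
  anticomm (i j : ι) (x : F) : A i (A j x) = -A j (A i x)
  adjoint_anticomm (i j : ι) (hij : i ≠ j) (x : F) : A i (((A j)†) x) = -((A j)†) (A i x)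
  adjoint_self (i : ι) (x : F) : A i (((A i)†) x) + ((A i)†) (A i x) = x

/-- The projection `∏ᵢ A i (A i)†` onto the states in which the modes of a list are empty. -/
def emptyProj (A : ι → F →L[ℂ] F) : List ι → F →L[ℂ] F
  | [] => .id ℂ F
  | i :: l => A i ∘L ((A i)†) ∘L emptyProj A l

namespace IsModeFamily

variable {A : ι → F →L[ℂ] F}

theorem norm_sq (hA : IsModeFamily A) (i : ι) (x : F) :
    ‖A i x‖ ^ 2 + ‖((A i)†) x‖ ^ 2 = ‖x‖ ^ 2 := by
  have h1 : (inner ℂ (A i x) (A i x) : ℂ) + inner ℂ (((A i)†) x) (((A i)†) x) = inner ℂ x x := by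
    rw [ContinuousLinearMap.adjoint_inner_left, ← ContinuousLinearMap.adjoint_inner_right,
      ← inner_add_right, add_comm, hA.adjoint_self]
  simp only [inner_self_eq_norm_sq_to_K] at h1
  exact_mod_cast h1

theorem norm_apply_le (hA : IsModeFamily A) (i : ι) (x : F) : ‖A i x‖ ≤ ‖x‖ := by
  refine le_of_sq_le_sq ?_ (norm_nonneg _)
  nlinarith [hA.norm_sq i x, sq_nonneg ‖((A i)†) x‖]

theorem norm_adjoint_apply_le (hA : IsModeFamily A) (i : ι) (x : F) : ‖((A i)†) x‖ ≤ ‖x‖ := by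
  refine le_of_sq_le_sq ?_ (norm_nonneg _)
  nlinarith [hA.norm_sq i x, sq_nonneg ‖A i x‖]

theorem self_apply (hA : IsModeFamily A) (i : ι) (x : F) : A i (A i x) = 0 := by
  have h := hA.anticomm i i x
  rw [eq_neg_iff_add_eq_zero, ← two_smul ℂ] at h
  simpa using h

theorem adjoint_adjoint_apply (hA : IsModeFamily A) (i j : ι) (x : F) :
    ((A i)†) (((A j)†) x) = -((A j)†) (((A i)†) x) := by
  refine ext_inner_left ℂ fun y => ?_
  rw [inner_neg_right]
  simp only [ContinuousLinearMap.adjoint_inner_right]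
  rw [hA.anticomm, inner_neg_left]

theorem norm_emptyProj_le (hA : IsModeFamily A) (l : List ι) (x : F) :
    ‖emptyProj A l x‖ ≤ ‖x‖ := by
  induction l with
  | nil => exact le_rfl
  | cons i l ih => exact (hA.norm_apply_le i _).trans ((hA.norm_adjoint_apply_le i _).trans ih)

theorem apply_emptyProj (hA : IsModeFamily A) {i : ι} {l : List ι} (hi : i ∉ l) (x : F) :
    A i (emptyProj A l x) = emptyProj A l (A i x) := by
  induction l with
  | nil => rfl
  | cons j l ih =>
    rw [List.mem_cons, not_or] at hi
    change A i (A j (((A j)†) (emptyProj A l x))) = A j (((A j)†) (emptyProj A l (A i x)))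
    rw [hA.anticomm, hA.adjoint_anticomm i j hi.1, ih hi.2]
    simp

theorem adjoint_apply_emptyProj (hA : IsModeFamily A) {i : ι} {l : List ι} (hi : i ∉ l) (x : F) :
    ((A i)†) (emptyProj A l x) = emptyProj A l (((A i)†) x) := by
  induction l with
  | nil => rfl
  | cons j l ih =>
    rw [List.mem_cons, not_or] at hi
    change ((A i)†) (A j (((A j)†) (emptyProj A l x))) =
      A j (((A j)†) (emptyProj A l (((A i)†) x)))
    rw [← ih hi.2, hA.adjoint_adjoint_apply j i, map_neg, hA.adjoint_anticomm j i (Ne.symm hi.1),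
      neg_neg]

theorem emptyProj_adjoint_apply (hA : IsModeFamily A) {i : ι} {l : List ι} (hl : l.Nodup)
    (hi : i ∈ l) (x : F) : emptyProj A l (((A i)†) x) = 0 := by
  induction l with
  | nil => simp at hi
  | cons j l ih =>
    rw [List.nodup_cons] at hl
    change A j (((A j)†) (emptyProj A l (((A i)†) x))) = 0
    by_cases hij : i = j
    · subst hij
      have h := hA.adjoint_adjoint_apply i i (emptyProj A l x)
      rw [eq_neg_iff_add_eq_zero, ← two_smul ℂ] at h
      rw [← hA.adjoint_apply_emptyProj hl.1, (smul_eq_zero.1 h).resolve_left two_ne_zero, map_zero]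
    · rw [ih hl.2 ((List.mem_cons.1 hi).resolve_left hij), map_zero, map_zero]

/-- Projecting one more mode to be empty lowers the expectation of the projection by at most the
expected number of particles in that mode. -/
theorem le_re_inner_emptyProj (hA : IsModeFamily A) {l : List ι} (hl : l.Nodup) (x : F) :
    ‖x‖ ^ 2 - (l.map fun i => ‖A i x‖ ^ 2).sum ≤ (inner ℂ x (emptyProj A l x) : ℂ).re := by
  induction l with
  | nil =>
    change ‖x‖ ^ 2 - 0 ≤ (inner ℂ x x : ℂ).re
    rw [sub_zero]
    exact (norm_sq_eq_re_inner (𝕜 := ℂ) x).le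
  | cons i l ih =>
    rw [List.nodup_cons] at hl
    have h1 : (inner ℂ x (emptyProj A (i :: l) x) : ℂ) =
        inner ℂ x (emptyProj A l x) - inner ℂ (A i x) (emptyProj A l (A i x)) := by
      change (inner ℂ x (A i (((A i)†) (emptyProj A l x))) : ℂ) = _
      rw [eq_sub_of_add_eq (hA.adjoint_self i (emptyProj A l x)), inner_sub_right,
        ContinuousLinearMap.adjoint_inner_right, hA.apply_emptyProj hl.1]
    have h2 : (inner ℂ (A i x) (emptyProj A l (A i x)) : ℂ).re ≤ ‖A i x‖ ^ 2 := by
      refine (Complex.re_le_norm _).trans ((norm_inner_le_norm _ _).trans ?_)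
      rw [sq]
      exact mul_le_mul_of_nonneg_left (hA.norm_emptyProj_le l _) (norm_nonneg _)
    rw [h1, Complex.sub_re, List.map_cons, List.sum_cons]
    linarith [ih hl.2]

/-- The vectors which become zero when sufficiently many modes are projected to be empty. -/
def occupied (A : ι → F →L[ℂ] F) : Submodule ℂ F where
  carrier := {x | ∃ s : Finset ι, ∀ l : List ι, l.Nodup → (∀ i ∈ s, i ∈ l) → emptyProj A l x = 0}
  zero_mem' := ⟨∅, fun l _ _ => map_zero _⟩
  add_mem' := by
    classical
    rintro x y ⟨s, hs⟩ ⟨t, ht⟩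
    refine ⟨s ∪ t, fun l hl h => ?_⟩
    rw [map_add, hs l hl fun i hi => h i (Finset.mem_union_left _ hi),
      ht l hl fun i hi => h i (Finset.mem_union_right _ hi), add_zero]
  smul_mem' := by
    rintro c x ⟨s, hs⟩
    exact ⟨s, fun l hl h => by rw [map_smul, hs l hl h, smul_zero]⟩

/-- If the expected total number of particles in `Ω` is less than one, the projection of `Ω` to the
joint vacuum of finitely many modes is bounded below, and a joint vacuum of all modes exists. -/
theorem exists_vacuum_of_sum_le (hA : IsModeFamily A) {Ω : F} (hΩ : ‖Ω‖ = 1) {c : ℝ} (hc : c < 1)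
    (h : ∀ s : Finset ι, ∑ i ∈ s, ‖A i Ω‖ ^ 2 ≤ c) : ∃ Φ : F, Φ ≠ 0 ∧ ∀ i, A i Φ = 0 := by
  classical
  by_cases hbot : (occupied A)ᗮ = ⊥
  · exfalso
    have h1 : Ω ∈ (occupied A).topologicalClosure := by
      rw [Submodule.topologicalClosure_eq_top_iff.2 hbot]
      trivial
    rw [← SetLike.mem_coe, Submodule.topologicalClosure_coe, Metric.mem_closure_iff] at h1
    obtain ⟨y, ⟨s, hs⟩, hy⟩ := h1 (1 - c) (by linarith)
    have h2 := hs s.toList s.nodup_toList fun i hi => Finset.mem_toList.2 hi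
    have h3 := hA.le_re_inner_emptyProj s.nodup_toList Ω
    rw [Finset.sum_map_toList, hΩ] at h3
    have h4 : (inner ℂ Ω (emptyProj A s.toList Ω) : ℂ).re ≤ ‖Ω - y‖ := by
      have : emptyProj A s.toList Ω = emptyProj A s.toList (Ω - y) := by
        rw [map_sub, h2, sub_zero]
      rw [this]
      refine (Complex.re_le_norm _).trans ((norm_inner_le_norm _ _).trans ?_)
      rw [hΩ, one_mul]
      exact hA.norm_emptyProj_le _ _
    rw [dist_eq_norm] at hy
    linarith [h s]
  · obtain ⟨Φ, hΦ, h0⟩ := Submodule.exists_mem_ne_zero_of_ne_bot hbot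
    refine ⟨Φ, h0, fun i => ?_⟩
    rw [← inner_self_eq_zero (𝕜 := ℂ), ← ContinuousLinearMap.adjoint_inner_left]
    refine (Submodule.mem_orthogonal _ _).1 hΦ _ ⟨{i}, fun l hl hi => ?_⟩
    exact hA.emptyProj_adjoint_apply hl (hi i (Finset.mem_singleton_self i)) _

/-- Finitely many further modes are emptied by applying their annihilation operators. -/
theorem exists_vacuum_of_finset (hA : IsModeFamily A) (s : Finset ι)
    (h : ∃ Φ : F, Φ ≠ 0 ∧ ∀ i ∉ s, A i Φ = 0) : ∃ Φ : F, Φ ≠ 0 ∧ ∀ i, A i Φ = 0 := by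
  classical
  induction s using Finset.induction_on with
  | empty => simpa using h
  | insert a s ha ih =>
    obtain ⟨Φ, h0, hΦ⟩ := h
    by_cases h1 : A a Φ = 0
    · refine ih ⟨Φ, h0, fun i hi => ?_⟩
      by_cases hia : i = a
      · rw [hia, h1]
      · exact hΦ i (by simp [hi, hia])
    · refine ih ⟨A a Φ, h1, fun i hi => ?_⟩
      by_cases hia : i = a
      · rw [hia, hA.self_apply]
      · rw [hA.anticomm, hΦ i (by simp [hi, hia]), map_zero, neg_zero]

/-- If the expected total number of particles in `Ω` is finite, a joint vacuum of all modes
exists. -/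
theorem exists_vacuum (hA : IsModeFamily A) {Ω : F} (hΩ : ‖Ω‖ = 1)
    (h : Summable fun i => ‖A i Ω‖ ^ 2) : ∃ Φ : F, Φ ≠ 0 ∧ ∀ i, A i Φ = 0 := by
  classical
  obtain ⟨s, hs⟩ := summable_iff_vanishing_norm.1 h (1 / 2) (by norm_num)
  refine hA.exists_vacuum_of_finset s ?_
  have hB : IsModeFamily fun i : {i // i ∉ s} => A i :=
    ⟨fun i j => hA.anticomm i j, fun i j hij => hA.adjoint_anticomm i j
      (fun h => hij (Subtype.ext h)), fun i => hA.adjoint_self i⟩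
  obtain ⟨Φ, h0, hΦ⟩ := hB.exists_vacuum_of_sum_le hΩ (c := 1 / 2) (by norm_num) fun t => by
    have h1 := hs (t.map (Function.Embedding.subtype _)) (by
      rw [Finset.disjoint_left]
      intro i hi
      obtain ⟨j, -, rfl⟩ := Finset.mem_map.1 hi
      exact j.2)
    rw [Finset.sum_map] at h1
    exact (le_abs_self _).trans h1.le
  exact ⟨Φ, h0, fun i hi => hΦ ⟨i, hi⟩⟩

end IsModeFamily

end Modes

/-! ### The exterior algebra acting by creation operators -/

section WedgeRep

variable {K F : Type*} [NormedAddCommGroup K] [InnerProductSpace ℂ K]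
  [NormedAddCommGroup F] [InnerProductSpace ℂ F] [CompleteSpace F] {c : K →ₗ[ℂ] F →L[ℂ] F}

/-- The action of the exterior algebra generated by the anticommuting operators `c f`. -/
def wedgeRep (hc : IsCAR c) : Wedge K →ₐ[ℂ] (F →L[ℂ] F) :=
  ExteriorAlgebra.lift ℂ ⟨c, fun f => by
    ext x
    exact hc.self_apply f x⟩

theorem wedgeRep_ι_mul (hc : IsCAR c) (f : K) (x : Wedge K) (z : F) :
    wedgeRep hc (Wedge.ι f * x) z = c f (wedgeRep hc x z) := by
  have h : wedgeRep hc (Wedge.ι f) = c f := ExteriorAlgebra.lift_ι_apply _ _ _ _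
  rw [map_mul, h]
  rfl

theorem wedgeRep_algebraMap (hc : IsCAR c) (r : ℂ) (z : F) :
    wedgeRep hc (algebraMap ℂ _ r) z = r • z := by
  rw [AlgHom.commutes]
  rfl

/-- On the range of the exterior algebra, the annihilation operator acts as the interior
multiplication, up to a term which vanishes on vectors annihilated by it. -/
theorem adjoint_wedgeRep (hc : IsCAR c) (f : K) (x : Wedge K) (z : F) :
    ((c f)†) (wedgeRep hc x z) =
      wedgeRep hc (Wedge.contract f x) z + wedgeRep hc (Wedge.invol x) (((c f)†) z) := by
  induction x using Wedge.induction with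
  | hr r =>
    rw [wedgeRep_algebraMap, AlgHom.commutes, wedgeRep_algebraMap, map_smul,
      Wedge.contract_algebraMap, map_zero, zero_apply, zero_add]
  | hadd x y hx hy =>
    simp only [map_add, add_apply, hx, hy]
    abel
  | hmul g x hx =>
    rw [wedgeRep_ι_mul, hc.adjoint_apply, hx, Wedge.contract_ι_mul, map_sub, map_smul, sub_apply,
      smul_apply, wedgeRep_ι_mul, map_mul, Wedge.invol_ι, neg_mul, map_neg, neg_apply,
      wedgeRep_ι_mul, map_add]
    abel

/-- An operator which anticommutes with all `c f` passes the action of the exterior algebra up to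
the grading automorphism. -/
theorem apply_wedgeRep (hc : IsCAR c) (B : F →L[ℂ] F) (hB : ∀ f z, B (c f z) = -c f (B z))
    (x : Wedge K) (z : F) :
    B (wedgeRep hc x z) = wedgeRep hc (Wedge.invol x) (B z) := by
  induction x using Wedge.induction with
  | hr r => rw [wedgeRep_algebraMap, AlgHom.commutes, wedgeRep_algebraMap, map_smul]
  | hadd x y hx hy => simp only [map_add, add_apply, hx, hy]
  | hmul g x hx =>
    rw [wedgeRep_ι_mul, hB, hx, map_mul, Wedge.invol_ι, neg_mul, map_neg, neg_apply,
      wedgeRep_ι_mul]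

end WedgeRep

/-! ### States obtained from a vacuum by creating electrons and holes -/

section FockVec

variable {H F : Type*} [NormedAddCommGroup H] [InnerProductSpace ℂ H]
  [NormedAddCommGroup F] [InnerProductSpace ℂ F] [CompleteSpace F] {ψ : H →ₗ[ℂ] F →L[ℂ] F}

theorem IsCAR.electron (hψ : IsCAR ψ) (V : Submodule ℂ H) :
    IsCAR (ψ ∘ₗ Vᗮ.subtypeₗᵢ.toLinearMap) :=
  hψ.comp _

theorem IsCAR.hole (hψ : IsCAR ψ) (V : Submodule ℂ H) :
    IsCAR (DiracSea.dualField (ψ ∘ₗ V.subtypeₗᵢ.toLinearMap)) :=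
  (hψ.comp _).dualField

/-- The state obtained from `Φ` by creating the holes `y` and then the electrons `x`. -/
def fockVec (hψ : IsCAR ψ) (V : Submodule ℂ H) (Φ : F) (x : Wedge Vᗮ)
    (y : Wedge (ConjSpace V)) : F :=
  wedgeRep (hψ.electron V) x (wedgeRep (hψ.hole V) y Φ)

variable (hψ : IsCAR ψ) {V : Submodule ℂ H} {Φ Z : F}

theorem fockVec_one_one (Φ : F) : fockVec hψ V Φ 1 1 = Φ := by
  simp [fockVec]

theorem fockVec_add_left (x x' : Wedge Vᗮ) (y : Wedge (ConjSpace V)) :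
    fockVec hψ V Φ (x + x') y = fockVec hψ V Φ x y + fockVec hψ V Φ x' y := by
  simp [fockVec]

theorem fockVec_add_right (x : Wedge Vᗮ) (y y' : Wedge (ConjSpace V)) :
    fockVec hψ V Φ x (y + y') = fockVec hψ V Φ x y + fockVec hψ V Φ x y' := by
  simp [fockVec]

theorem fockVec_algebraMap_left (r : ℂ) (y : Wedge (ConjSpace V)) :
    fockVec hψ V Φ (algebraMap ℂ _ r) y = r • fockVec hψ V Φ 1 y := by
  rw [fockVec, wedgeRep_algebraMap, fockVec, map_one]
  rfl

theorem fockVec_algebraMap_right (x : Wedge Vᗮ) (r : ℂ) :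
    fockVec hψ V Φ x (algebraMap ℂ _ r) = r • fockVec hψ V Φ x 1 := by
  rw [fockVec, wedgeRep_algebraMap, map_smul, fockVec, map_one]
  rfl

theorem apply_fockVec_electron (u : Vᗮ) (x : Wedge Vᗮ) (y : Wedge (ConjSpace V)) :
    ψ u (fockVec hψ V Φ x y) = fockVec hψ V Φ (Wedge.ι u * x) y :=
  (wedgeRep_ι_mul (hψ.electron V) u x _).symm

theorem adjoint_fockVec_hole (v : V) (x : Wedge Vᗮ) (y : Wedge (ConjSpace V)) :
    ((ψ v)†) (fockVec hψ V Φ x y) =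
      fockVec hψ V Φ (Wedge.invol x) (Wedge.ι (ConjSpace.of v) * y) := by
  rw [fockVec, apply_wedgeRep (hψ.electron V) _ (fun u z => ?_), fockVec, wedgeRep_ι_mul]
  · rfl
  · have h := hψ.adjoint_apply (v : H) (u : H) z
    rw [Submodule.inner_right_of_mem_orthogonal v.2 u.2, zero_smul, zero_sub] at h
    exact h

theorem adjoint_fockVec_electron (hΦ : IsVacuum ψ V Φ) (u : Vᗮ) (x : Wedge Vᗮ)
    (y : Wedge (ConjSpace V)) :
    ((ψ u)†) (fockVec hψ V Φ x y) = fockVec hψ V Φ (Wedge.contract u x) y := by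
  have h1 := adjoint_wedgeRep (hψ.electron V) u x (wedgeRep (hψ.hole V) y Φ)
  have h2 : ((ψ u)†) (wedgeRep (hψ.hole V) y Φ) = 0 := by
    rw [apply_wedgeRep (hψ.hole V) _ (fun v z => hψ.adjoint_anticomm _ _ z),
      hΦ.adjoint_apply_eq_zero _ u.2, map_zero]
  refine h1.trans ?_
  change _ + wedgeRep (hψ.electron V) _ (((ψ u)†) (wedgeRep (hψ.hole V) y Φ)) = _
  rw [h2, map_zero, add_zero]
  rfl

theorem apply_fockVec_hole (hΦ : IsVacuum ψ V Φ) (v : V) (x : Wedge Vᗮ)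
    (y : Wedge (ConjSpace V)) :
    ψ v (fockVec hψ V Φ x y) =
      fockVec hψ V Φ (Wedge.invol x) (Wedge.contract (ConjSpace.of v) y) := by
  have h1 := adjoint_wedgeRep (hψ.hole V) (ConjSpace.of v) y Φ
  have h2 : (dualField (ψ ∘ₗ V.subtypeₗᵢ.toLinearMap) (ConjSpace.of v))† = ψ v :=
    ContinuousLinearMap.adjoint_adjoint _
  rw [h2, hΦ.apply_eq_zero _ v.2, map_zero, add_zero] at h1
  rw [fockVec, apply_wedgeRep (hψ.electron V) _ (fun u z => hψ.anticomm _ _ z), h1]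
  rfl

/-- The states created from two vacua have the scalar products of the Fock space, whatever the
representation. -/
theorem inner_fockVec (hZ : IsVacuum ψ V Z) (hΦ : IsVacuum ψ V Φ) (x x' : Wedge Vᗮ)
    (y y' : Wedge (ConjSpace V)) :
    (inner ℂ (fockVec hψ V Z x y) (fockVec hψ V Φ x' y') : ℂ) =
      Wedge.form x x' * Wedge.form y y' * inner ℂ Z Φ := by
  -- Creation operators on the left act as interior multiplications on the right and are used up
  -- first. A creation operator left over on the right annihilates the vacuum on the left.
  induction x using Wedge.induction generalizing x' with
  | hadd x₁ x₂ h₁ h₂ =>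
    rw [fockVec_add_left, inner_add_left, h₁, h₂, Wedge.form_add_left]
    ring
  | hmul u x h =>
    rw [← apply_fockVec_electron, ← ContinuousLinearMap.adjoint_inner_right,
      adjoint_fockVec_electron hψ hΦ, h, Wedge.form_ι_mul_left]
  | hr r =>
    rw [fockVec_algebraMap_left, inner_smul_left, Wedge.form_algebraMap_left, mul_assoc, mul_assoc]
    congr 1
    induction x' using Wedge.induction with
    | hadd x₁ x₂ h₁ h₂ =>
      rw [fockVec_add_left, inner_add_right, h₁, h₂, map_add]
      ring
    | hmul u x h =>
      rw [← apply_fockVec_electron, ← ContinuousLinearMap.adjoint_inner_left,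
        adjoint_fockVec_electron hψ hZ, Wedge.contract_one, Wedge.vac_ι_mul, zero_mul]
      simp [fockVec]
    | hr s =>
      rw [fockVec_algebraMap_left, inner_smul_right, AlgHom.commutes]
      change _ = s * _
      congr 1
      induction y using Wedge.induction generalizing y' with
      | hadd y₁ y₂ h₁ h₂ =>
        rw [fockVec_add_right, inner_add_left, h₁, h₂, Wedge.form_add_left]
        ring
      | hmul v y h =>
        have h1 := adjoint_fockVec_hole hψ (Φ := Z) (ConjSpace.of.symm v) 1 y
        rw [map_one] at h1
        change _ = fockVec hψ V Z 1 (Wedge.ι v * y) at h1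
        rw [← h1, ContinuousLinearMap.adjoint_inner_left, apply_fockVec_hole hψ hΦ, map_one,
          Wedge.form_ι_mul_left]
        exact h _
      | hr t =>
        rw [fockVec_algebraMap_right, inner_smul_left, Wedge.form_algebraMap_left, mul_assoc,
          fockVec_one_one]
        congr 1
        induction y' using Wedge.induction with
        | hadd y₁ y₂ h₁ h₂ =>
          rw [fockVec_add_right, inner_add_right, h₁, h₂, map_add]
          ring
        | hmul v y h =>
          have h1 := adjoint_fockVec_hole hψ (Φ := Φ) (ConjSpace.of.symm v) 1 y
          rw [map_one] at h1
          change _ = fockVec hψ V Φ 1 (Wedge.ι v * y) at h1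
          rw [← h1, ContinuousLinearMap.adjoint_inner_right, hZ.apply_eq_zero _ (Subtype.mem _),
            Wedge.vac_ι_mul, inner_zero_left, zero_mul]
        | hr t =>
          rw [fockVec_algebraMap_right, inner_smul_right, fockVec_one_one, AlgHom.commutes]
          rfl

variable [V.HasOrthogonalProjection]

theorem apply_fockVec (hΦ : IsVacuum ψ V Φ) (f : H) (x : Wedge Vᗮ) (y : Wedge (ConjSpace V)) :
    ψ f (fockVec hψ V Φ x y) =
      fockVec hψ V Φ (Wedge.ι (Vᗮ.orthogonalProjectionOnto f) * x) y +
        fockVec hψ V Φ (Wedge.invol x)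
          (Wedge.contract (ConjSpace.of (V.orthogonalProjectionOnto f)) y) := by
  conv_lhs => rw [← V.starProjection_add_starProjection_orthogonal f]
  rw [map_add, add_apply, ← apply_fockVec_electron, ← apply_fockVec_hole hψ hΦ, add_comm]
  rfl

theorem adjoint_fockVec (hΦ : IsVacuum ψ V Φ) (f : H) (x : Wedge Vᗮ) (y : Wedge (ConjSpace V)) :
    ((ψ f)†) (fockVec hψ V Φ x y) =
      fockVec hψ V Φ (Wedge.contract (Vᗮ.orthogonalProjectionOnto f) x) y +
        fockVec hψ V Φ (Wedge.invol x)
          (Wedge.ι (ConjSpace.of (V.orthogonalProjectionOnto f)) * y) := by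
  conv_lhs => rw [← V.starProjection_add_starProjection_orthogonal f]
  rw [map_add, map_add, add_apply, ← adjoint_fockVec_electron hψ hΦ, ← adjoint_fockVec_hole,
    add_comm]
  rfl

theorem span_fockVec_dense (hΦ : IsVacuum ψ V Φ) (hc : IsCyclic ψ Φ) :
    (Submodule.span ℂ (Set.range fun p : Wedge Vᗮ × Wedge (ConjSpace V) =>
      fockVec hψ V Φ p.1 p.2)).topologicalClosure = ⊤ := by
  set R := Submodule.span ℂ (Set.range fun p : Wedge Vᗮ × Wedge (ConjSpace V) =>
    fockVec hψ V Φ p.1 p.2) with hR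
  have key (A : F →L[ℂ] F) (hA : ∀ x y, A (fockVec hψ V Φ x y) ∈ R) (x : F) (hx : x ∈ R) :
      A x ∈ R := by
    have : R ≤ R.comap A.toLinearMap := by
      conv_lhs => rw [hR]
      refine Submodule.span_le.2 ?_
      rintro _ ⟨p, rfl⟩
      exact hA p.1 p.2
    exact this hx
  refine hc.topologicalClosure_eq_top ?_ (fun f => key _ fun x y => ?_)
    (fun f => key _ fun x y => ?_)
  · exact Submodule.subset_span ⟨(1, 1), fockVec_one_one hψ Φ⟩
  · rw [apply_fockVec hψ hΦ]
    exact add_mem (Submodule.subset_span ⟨(_, _), rfl⟩) (Submodule.subset_span ⟨(_, _), rfl⟩)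
  · rw [adjoint_fockVec hψ hΦ]
    exact add_mem (Submodule.subset_span ⟨(_, _), rfl⟩) (Submodule.subset_span ⟨(_, _), rfl⟩)

end FockVec

/-! ### Uniqueness of Fock representations -/

section Uniqueness

/-- Two families of vectors with the same Gram matrix are related by an isometry. -/
theorem exists_linearIsometry_of_inner_eq {D E E' : Type*} [NormedAddCommGroup E]
    [InnerProductSpace ℂ E] [NormedAddCommGroup E'] [InnerProductSpace ℂ E'] [CompleteSpace E']
    (α : D → E) (β : D → E') (h : ∀ d d', (inner ℂ (α d) (α d') : ℂ) = inner ℂ (β d) (β d'))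
    (hα : (Submodule.span ℂ (Set.range α)).topologicalClosure = ⊤) :
    ∃ J : E →ₗᵢ[ℂ] E', ∀ d, J (α d) = β d := by
  have hn (c : D →₀ ℂ) :
      ‖Finsupp.linearCombination ℂ β c‖ = ‖Finsupp.linearCombination ℂ α c‖ := by
    rw [@norm_eq_sqrt_re_inner ℂ,
      @norm_eq_sqrt_re_inner ℂ _ _ _ _ (Finsupp.linearCombination ℂ α c)]
    simp only [Finsupp.linearCombination_apply, Finsupp.sum, sum_inner, inner_sum, inner_smul_left,
      inner_smul_right, h]
  have hd : DenseRange (Finsupp.linearCombination ℂ α) := by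
    rw [← Submodule.dense_iff_topologicalClosure_eq_top, ← Finsupp.range_linearCombination] at hα
    exact hα
  have hb : ∃ C : ℝ, ∀ c, ‖Finsupp.linearCombination ℂ β c‖ ≤
      C * ‖Finsupp.linearCombination ℂ α c‖ :=
    ⟨1, fun c => by rw [hn, one_mul]⟩
  let J := (Finsupp.linearCombination ℂ β).extendOfNorm (Finsupp.linearCombination ℂ α)
  have hJ (c) : J (Finsupp.linearCombination ℂ α c) = Finsupp.linearCombination ℂ β c :=
    LinearMap.extendOfNorm_eq hd hb c
  refine ⟨⟨J.toLinearMap, fun x => ?_⟩, fun d => ?_⟩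
  · refine hd.induction_on (p := fun x => ‖J x‖ = ‖x‖) x
      (isClosed_eq J.continuous.norm continuous_norm) fun c => ?_
    rw [hJ, hn]
  · have := hJ (Finsupp.single d 1)
    simpa using this

variable {H F F' : Type*} [NormedAddCommGroup H] [InnerProductSpace ℂ H]
  [NormedAddCommGroup F] [InnerProductSpace ℂ F] [CompleteSpace F]
  [NormedAddCommGroup F'] [InnerProductSpace ℂ F'] [CompleteSpace F']
  {ψ : H →ₗ[ℂ] F →L[ℂ] F} {ψ' : H →ₗ[ℂ] F' →L[ℂ] F'} {V Q : Submodule ℂ H}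
  [V.HasOrthogonalProjection] [Q.HasOrthogonalProjection]

/-- A Fock representation embeds into every representation which contains a vacuum for the same
polarization. -/
theorem IsFock.exists_intertwiner {Ω : F} (hΩ : IsFock ψ V Ω) (hψ' : IsCAR ψ') {Φ : F'}
    (hΦ : IsVacuum ψ' V Φ) (h1 : ‖Φ‖ = 1) :
    ∃ J : F →ₗᵢ[ℂ] F', J Ω = Φ ∧ (∀ f x, J (ψ f x) = ψ' f (J x)) ∧
      ∀ f x, J (((ψ f)†) x) = ((ψ' f)†) (J x) := by
  have hd := span_fockVec_dense hΩ.isCAR hΩ.isVacuum hΩ.isCyclic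
  obtain ⟨J, hJ⟩ := exists_linearIsometry_of_inner_eq
    (fun p : Wedge Vᗮ × Wedge (ConjSpace V) => fockVec hΩ.isCAR V Ω p.1 p.2)
    (fun p => fockVec hψ' V Φ p.1 p.2) (fun p p' => by
      rw [inner_fockVec _ hΩ.isVacuum hΩ.isVacuum, inner_fockVec _ hΦ hΦ,
        inner_self_eq_norm_sq_to_K, inner_self_eq_norm_sq_to_K, h1, hΩ.norm_eq_one]) hd
  have hJ' (x y) : J (fockVec hΩ.isCAR V Ω x y) = fockVec hψ' V Φ x y := hJ (x, y)
  rw [← Submodule.dense_iff_topologicalClosure_eq_top] at hd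
  refine ⟨J, ?_, fun f x => ?_, fun f x => ?_⟩
  · simpa [fockVec_one_one] using hJ' 1 1
  · refine DFunLike.congr_fun (ContinuousLinearMap.ext_on (f := J.toContinuousLinearMap ∘L ψ f)
      (g := ψ' f ∘L J.toContinuousLinearMap) hd ?_) x
    rintro _ ⟨p, rfl⟩
    change J (ψ f _) = ψ' f (J _)
    rw [apply_fockVec _ hΩ.isVacuum, map_add, hJ', hJ', hJ', apply_fockVec _ hΦ]
  · refine DFunLike.congr_fun (ContinuousLinearMap.ext_on (f := J.toContinuousLinearMap ∘L (ψ f)†)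
      (g := (ψ' f)† ∘L J.toContinuousLinearMap) hd ?_) x
    rintro _ ⟨p, rfl⟩
    change J (((ψ f)†) _) = ((ψ' f)†) (J _)
    rw [adjoint_fockVec _ hΩ.isVacuum, map_add, hJ', hJ', hJ', adjoint_fockVec _ hΦ]

/-- The vacuum of a Fock representation is unique up to a factor. -/
theorem IsFock.mem_span_of_isVacuum {Ω Z : F} (hΩ : IsFock ψ V Ω) (hZ : IsVacuum ψ V Z) :
    Z ∈ Submodule.span ℂ {Ω} := by
  have h0 : IsVacuum ψ V (Z - (inner ℂ Ω Z : ℂ) • Ω) := by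
    constructor
    · intro f hf
      rw [map_sub, hZ.apply_eq_zero f hf, (hΩ.isVacuum.smul _).apply_eq_zero f hf, sub_zero]
    · intro f hf
      rw [map_sub, hZ.adjoint_apply_eq_zero f hf, (hΩ.isVacuum.smul _).adjoint_apply_eq_zero f hf,
        sub_zero]
  have h1 : (inner ℂ Ω (Z - (inner ℂ Ω Z : ℂ) • Ω) : ℂ) = 0 := by
    rw [inner_sub_right, inner_smul_right, inner_self_eq_norm_sq_to_K, hΩ.norm_eq_one]
    simp
  have h2 : Z - (inner ℂ Ω Z : ℂ) • Ω ∈ (Submodule.span ℂ (Set.range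
      fun p : Wedge Vᗮ × Wedge (ConjSpace V) => fockVec hΩ.isCAR V Ω p.1 p.2))ᗮ := by
    rw [Submodule.mem_orthogonal]
    have : Submodule.span ℂ (Set.range
      fun p : Wedge Vᗮ × Wedge (ConjSpace V) => fockVec hΩ.isCAR V Ω p.1 p.2) ≤
        (Submodule.span ℂ {Z - (inner ℂ Ω Z : ℂ) • Ω})ᗮ := by
      refine Submodule.span_le.2 ?_
      rintro _ ⟨p, rfl⟩
      rw [SetLike.mem_coe, Submodule.mem_orthogonal_singleton_iff_inner_left]
      have := inner_fockVec hΩ.isCAR hΩ.isVacuum h0 p.1 1 p.2 1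
      rwa [fockVec_one_one, h1, mul_zero] at this
    exact fun u hu => Submodule.mem_orthogonal_singleton_iff_inner_left.1 (this hu)
  rw [Submodule.topologicalClosure_eq_top_iff.1
    (span_fockVec_dense hΩ.isCAR hΩ.isVacuum hΩ.isCyclic), Submodule.mem_bot, sub_eq_zero] at h2
  rw [h2]
  exact Submodule.smul_mem _ _ (Submodule.mem_span_singleton_self _)

/-- If each of two Fock representations contains a vacuum for the polarization of the other one,
they are unitarily equivalent: the image of the first representation in the second one contains
the vacuum of the latter, as this is unique up to a factor. -/
theorem IsFock.exists_unitary {Ω : F} {Ω' : F'} (hΩ : IsFock ψ V Ω) (hΩ' : IsFock ψ' Q Ω')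
    {Φ : F} {Φ' : F'} (hΦ : IsVacuum ψ Q Φ) (hΦ0 : Φ ≠ 0) (hΦ' : IsVacuum ψ' V Φ') (hΦ'0 : Φ' ≠ 0) :
    ∃ T : F ≃ₗᵢ[ℂ] F', ∀ f x, T (ψ f x) = ψ' f (T x) := by
  obtain ⟨J, -, hJ, hJa⟩ := hΩ.exists_intertwiner hΩ'.isCAR
    (hΦ'.smul ((‖Φ'‖⁻¹ : ℝ) : ℂ)) (by
      rw [norm_smul, Complex.norm_real, norm_inv, norm_norm,
        inv_mul_cancel₀ (norm_ne_zero_iff.2 hΦ'0)])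
  have hJΦ : IsVacuum ψ' Q (J Φ) :=
    ⟨fun f hf => by rw [← hJ, hΦ.apply_eq_zero f hf, map_zero],
      fun f hf => by rw [← hJa, hΦ.adjoint_apply_eq_zero f hf, map_zero]⟩
  have htop : LinearMap.range J.toLinearMap = ⊤ := by
    refine hΩ'.isCyclic _ ?_ ?_ ?_ ?_
    · rw [LinearMap.coe_range]
      exact J.isometry.isClosedEmbedding.isClosed_range
    · obtain ⟨c, hc⟩ := Submodule.mem_span_singleton.1 (hΩ'.mem_span_of_isVacuum hJΦ)
      have hc0 : c ≠ 0 := by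
        rintro rfl
        rw [zero_smul] at hc
        exact hΦ0 ((map_eq_zero_iff J J.injective).1 hc.symm)
      refine ⟨c⁻¹ • Φ, ?_⟩
      change J (c⁻¹ • Φ) = Ω'
      rw [map_smul, ← hc, smul_smul, inv_mul_cancel₀ hc0, one_smul]
    · rintro f _ ⟨x, rfl⟩
      exact ⟨ψ f x, hJ f x⟩
    · rintro f _ ⟨x, rfl⟩
      exact ⟨((ψ f)†) x, hJa f x⟩
  exact ⟨LinearIsometryEquiv.ofSurjective J (LinearMap.range_eq_top.1 htop), hJ⟩

end Uniqueness

/-! ### Hilbert–Schmidt operators -/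

section HilbertSchmidt

variable {H H' : Type*} [NormedAddCommGroup H] [InnerProductSpace ℂ H]
  [NormedAddCommGroup H'] [InnerProductSpace ℂ H']

theorem hasSum_norm_inner_sq {ι : Type*} (b : HilbertBasis ι ℂ H) (x : H) :
    HasSum (fun i => ‖(inner ℂ (b i) x : ℂ)‖ ^ 2) (‖x‖ ^ 2) := by
  have h := Complex.hasSum_re (b.hasSum_inner_mul_inner x x)
  have h1 : (inner ℂ x x : ℂ).re = ‖x‖ ^ 2 := (norm_sq_eq_re_inner (𝕜 := ℂ) x).symm
  rw [h1] at h
  convert h using 2 with i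
  rw [← inner_conj_symm x, RCLike.conj_mul]
  norm_cast

/-- The sums `∑ᵢ ‖T eᵢ‖²` are bounded uniformly over all finite orthonormal families. -/
def HasHSBound (T : H →L[ℂ] H') : Prop :=
  ∃ C : ℝ, ∀ (n : ℕ) (e : Fin n → H), Orthonormal ℂ e → ∑ i, ‖T (e i)‖ ^ 2 ≤ C

theorem HasHSBound.summable {T : H →L[ℂ] H'} (hT : HasHSBound T) {ι : Type*} {e : ι → H}
    (he : Orthonormal ℂ e) : Summable fun i => ‖T (e i)‖ ^ 2 := by
  obtain ⟨C, hC⟩ := hT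
  refine summable_of_sum_le (c := C) (fun i => by positivity) fun s => ?_
  have h := hC s.card (fun i => e (s.equivFin.symm i)) (he.comp _
    (Subtype.val_injective.comp s.equivFin.symm.injective))
  rw [← Finset.sum_coe_sort s]
  rwa [s.equivFin.symm.sum_comp (fun i => ‖T (e i)‖ ^ 2)] at h

variable [CompleteSpace H]

theorem HasHSBound.isHilbertSchmidt {T : H →L[ℂ] H'} (hT : HasHSBound T) : IsHilbertSchmidt T := by
  obtain ⟨w, b, -⟩ := exists_hilbertBasis ℂ H
  exact ⟨w, b, hT.summable b.orthonormal⟩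

variable [CompleteSpace H']

theorem IsHilbertSchmidt.hasHSBound_adjoint {T : H →L[ℂ] H'} (hT : IsHilbertSchmidt T) :
    HasHSBound (T†) := by
  obtain ⟨w, b, hb⟩ := hT
  refine ⟨∑' i, ‖T (b i)‖ ^ 2, fun n e he => ?_⟩
  refine hasSum_le (fun i => ?_) (hasSum_sum fun j _ => hasSum_norm_inner_sq b ((T†) (e j)))
    hb.hasSum
  simp only [ContinuousLinearMap.adjoint_inner_right]
  simp only [norm_inner_symm (T (b i))]
  exact he.sum_inner_products_le _

theorem IsHilbertSchmidt.adjoint {T : H →L[ℂ] H'} (hT : IsHilbertSchmidt T) :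
    IsHilbertSchmidt (T†) :=
  hT.hasHSBound_adjoint.isHilbertSchmidt

theorem IsHilbertSchmidt.hasHSBound {T : H →L[ℂ] H'} (hT : IsHilbertSchmidt T) : HasHSBound T := by
  have := hT.adjoint.hasHSBound_adjoint
  rwa [ContinuousLinearMap.adjoint_adjoint] at this

/-- It suffices to test `B ∘ P^V` on orthonormal families in `V`. -/
theorem isHilbertSchmidt_comp_starProjection {V : Submodule ℂ H} [CompleteSpace V]
    (B : H →L[ℂ] H') {C : ℝ} (hB : ∀ (n : ℕ) (e : Fin n → H), Orthonormal ℂ e → (∀ i, e i ∈ V) →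
      ∑ i, ‖B (e i)‖ ^ 2 ≤ C) : IsHilbertSchmidt (B ∘L V.starProjection) := by
  have h1 : HasHSBound (B ∘L V.subtypeL) := ⟨C, fun n e he =>
    hB n (fun i => (e i : H)) (he.comp_linearIsometry V.subtypeₗᵢ) fun i => (e i).2⟩
  obtain ⟨D, hD⟩ := h1.isHilbertSchmidt.hasHSBound_adjoint
  have h2 : HasHSBound ((B ∘L V.starProjection)†) := by
    refine ⟨D, fun n e he => ?_⟩
    have h3 : B ∘L V.starProjection = (B ∘L V.subtypeL) ∘L V.orthogonalProjectionOnto := rfl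
    rw [h3, ContinuousLinearMap.adjoint_comp, Submodule.adjoint_orthogonalProjectionOnto]
    exact hD n e he
  have := h2.isHilbertSchmidt.adjoint
  rwa [ContinuousLinearMap.adjoint_adjoint] at this

end HilbertSchmidt

/-! ### Equivalence of Fock representations -/

section Equivalence

variable {H F F' : Type*} [NormedAddCommGroup H] [InnerProductSpace ℂ H]
  [NormedAddCommGroup F] [InnerProductSpace ℂ F] [CompleteSpace F]
  [NormedAddCommGroup F'] [InnerProductSpace ℂ F'] [CompleteSpace F']
  {ψ : H →ₗ[ℂ] F →L[ℂ] F} {ψ' : H →ₗ[ℂ] F' →L[ℂ] F'} {V Q : Submodule ℂ H}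

theorem inner_starProjection_starProjection_orthogonal [Q.HasOrthogonalProjection] (x y : H) :
    (inner ℂ (Q.starProjection x) (Qᗮ.starProjection y) : ℂ) = 0 :=
  Submodule.inner_right_of_mem_orthogonal (Q.starProjection_apply_mem x)
    (Qᗮ.starProjection_apply_mem y)

theorem orthonormal_conjSpace_of {ι : Type*} {e : ι → H} (he : Orthonormal ℂ e) :
    Orthonormal ℂ fun i => ConjSpace.of (e i) :=
  ⟨he.1, fun _ _ hij => he.2 hij.symm⟩

theorem IsCAR.continuous_apply (hψ : IsCAR ψ) (Φ : F) : Continuous fun f => ψ f Φ :=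
  (LinearMap.mkContinuous ((ContinuousLinearMap.apply ℂ F Φ).toLinearMap ∘ₗ ψ) ‖Φ‖ fun f => by
    rw [mul_comm]
    exact hψ.norm_apply_le f Φ).continuous

theorem IsCAR.continuous_adjoint_apply (hψ : IsCAR ψ) (Φ : F) :
    Continuous fun f => ((ψ f)†) Φ :=
  hψ.dualField.continuous_apply Φ

theorem eq_top_of_hilbertBasis_mem {K ι : Type*} [NormedAddCommGroup K] [InnerProductSpace ℂ K]
    (b : HilbertBasis ι ℂ K) (R : Submodule ℂ K) (hR : IsClosed (R : Set K)) (h : ∀ i, b i ∈ R) :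
    R = ⊤ := by
  rw [eq_top_iff, ← b.dense_span]
  refine Submodule.topologicalClosure_minimal _ (Submodule.span_le.2 ?_) hR
  rintro _ ⟨i, rfl⟩
  exact h i

theorem IsCAR.isVacuum_of_hilbertBasis (hψ : IsCAR ψ) {ι κ : Type*} (b : HilbertBasis ι ℂ Q)
    (c : HilbertBasis κ ℂ Qᗮ) {Φ : F} (hb : ∀ i, ψ (b i) Φ = 0) (hc : ∀ j, ((ψ (c j))†) Φ = 0) :
    IsVacuum ψ Q Φ := by
  constructor
  · intro f hf
    let R : Submodule ℂ Q :=
      { carrier := {g | ψ g Φ = 0}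
        zero_mem' := by simp
        add_mem' := fun {x y} hx hy => by
          change ψ (x + y) Φ = 0
          rw [map_add, add_apply, show ψ x Φ = 0 from hx, show ψ y Φ = 0 from hy, add_zero]
        smul_mem' := fun a x hx => by
          change ψ (a • x) Φ = 0
          rw [map_smul, smul_apply, show ψ x Φ = 0 from hx, smul_zero] }
    have hR := eq_top_of_hilbertBasis_mem b R
      (isClosed_eq ((hψ.continuous_apply Φ).comp continuous_subtype_val) continuous_const) hb
    have h : (⟨f, hf⟩ : Q) ∈ R := hR ▸ Submodule.mem_top
    exact h
  · intro f hf
    let R : Submodule ℂ Qᗮ :=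
      { carrier := {g | ((ψ g)†) Φ = 0}
        zero_mem' := by simp
        add_mem' := fun {x y} hx hy => by
          change ((ψ (x + y))†) Φ = 0
          rw [map_add, map_add, add_apply, show ((ψ x)†) Φ = 0 from hx,
            show ((ψ y)†) Φ = 0 from hy, add_zero]
        smul_mem' := fun a x hx => by
          change ((ψ (a • x))†) Φ = 0
          rw [map_smul, LinearIsometryEquiv.map_smulₛₗ, smul_apply, show ((ψ x)†) Φ = 0 from hx,
            smul_zero] }
    have hR := eq_top_of_hilbertBasis_mem c R
      (isClosed_eq ((hψ.continuous_adjoint_apply Φ).comp continuous_subtype_val) continuous_const)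
      hc
    have h : (⟨f, hf⟩ : Qᗮ) ∈ R := hR ▸ Submodule.mem_top
    exact h

/-- The modes whose joint vacua are the vacua for `Q`: creation operators for an orthonormal family
in `Q`, annihilation operators for one in `Qᗮ`. -/
theorem IsCAR.isModeFamily (hψ : IsCAR ψ) {ι κ : Type*} {b : ι → Q} {c : κ → Qᗮ}
    (hb : Orthonormal ℂ b) (hc : Orthonormal ℂ c) :
    IsModeFamily (Sum.elim (fun i => ψ (b i)) fun j => (ψ (c j))†) := by
  have hbb (i j) (hij : i ≠ j) : (inner ℂ (b i : H) (b j : H) : ℂ) = 0 := hb.2 hij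
  have hcc (i j) (hij : i ≠ j) : (inner ℂ (c i : H) (c j : H) : ℂ) = 0 := hc.2 hij
  have hcb (i j) : (inner ℂ (c j : H) (b i : H) : ℂ) = 0 :=
    Submodule.inner_left_of_mem_orthogonal (b i).2 (c j).2
  have hb1 (i) : (inner ℂ (b i : H) (b i : H) : ℂ) = 1 := by
    have : ‖(b i : H)‖ = 1 := hb.1 i
    rw [inner_self_eq_norm_sq_to_K, this]
    simp
  have hc1 (i) : (inner ℂ (c i : H) (c i : H) : ℂ) = 1 := by
    have : ‖(c i : H)‖ = 1 := hc.1 i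
    rw [inner_self_eq_norm_sq_to_K, this]
    simp
  refine ⟨?_, ?_, ?_⟩
  · rintro (i | i) (j | j) x
    · exact hψ.anticomm _ _ x
    · simp [hψ.apply_adjoint, hcb]
    · simp [hψ.adjoint_apply, hcb]
    · exact hψ.adjoint_anticomm _ _ x
  · rintro (i | i) (j | j) hij x
    · have h : j ≠ i := fun h => hij (by rw [h])
      simp [hψ.apply_adjoint, hbb j i h]
    · simp [hψ.anticomm (b i : H)]
    · simp [hψ.adjoint_anticomm (c i : H)]
    · have h : i ≠ j := fun h => hij (by rw [h])
      simp [hψ.adjoint_apply, hcc i j h]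
  · rintro (i | i) x
    · simp [hψ.apply_adjoint, hb1, -inner_self_eq_norm_sq_to_K]
    · simp [hψ.adjoint_apply, hc1, -inner_self_eq_norm_sq_to_K]

theorem IsFock.norm_apply_le [V.HasOrthogonalProjection]
    [Q.HasOrthogonalProjection] {Ω : F} (hΩ : IsFock ψ V Ω) {f : H} (hf : f ∈ Q) :
    ‖ψ f Ω‖ ≤ ‖(Vᗮ.starProjection ∘L Q.starProjection) f‖ := by
  have h1 : ψ f Ω = ψ (Vᗮ.starProjection f) Ω := by
    conv_lhs => rw [← V.starProjection_add_starProjection_orthogonal f]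
    rw [map_add, add_apply, hΩ.isVacuum.apply_eq_zero _ (V.starProjection_apply_mem _), zero_add]
  have h2 := hΩ.isCAR.norm_apply_le (Vᗮ.starProjection f) Ω
  rw [hΩ.norm_eq_one, mul_one, ← h1] at h2
  rwa [ContinuousLinearMap.comp_apply, Submodule.starProjection_eq_self_iff.2 hf]

theorem IsFock.norm_adjoint_apply_le [V.HasOrthogonalProjection]
    [Q.HasOrthogonalProjection] {Ω : F} (hΩ : IsFock ψ V Ω) {f : H} (hf : f ∈ Qᗮ) :
    ‖((ψ f)†) Ω‖ ≤ ‖(V.starProjection ∘L Qᗮ.starProjection) f‖ := by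
  have h1 : ((ψ f)†) Ω = ((ψ (V.starProjection f))†) Ω := by
    conv_lhs => rw [← V.starProjection_add_starProjection_orthogonal f]
    rw [map_add, map_add, add_apply,
      hΩ.isVacuum.adjoint_apply_eq_zero _ (Vᗮ.starProjection_apply_mem _), add_zero]
  have h2 := hΩ.isCAR.norm_adjoint_apply_le (V.starProjection f) Ω
  rw [hΩ.norm_eq_one, mul_one, ← h1] at h2
  rwa [ContinuousLinearMap.comp_apply, Submodule.starProjection_eq_self_iff.2 hf]

variable [CompleteSpace H] [CompleteSpace V] [CompleteSpace Q]

theorem adjoint_starProjection_comp :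
    (Q.starProjection ∘L V.starProjection)† = V.starProjection ∘L Q.starProjection := by
  rw [ContinuousLinearMap.adjoint_comp, (isSelfAdjoint_starProjection V).adjoint_eq,
    (isSelfAdjoint_starProjection Q).adjoint_eq]

/-- A vacuum for `Q` in the Fock representation of `V` contains finitely many electrons on the
average. -/
theorem IsFock.isHilbertSchmidt_of_isVacuum {Ω Φ : F} (hΩ : IsFock ψ V Ω) (hΦ : IsVacuum ψ Q Φ)
    (h0 : Φ ≠ 0) : IsHilbertSchmidt (Qᗮ.starProjection ∘L V.starProjection) := by
  obtain ⟨C, hC⟩ := hΩ.isCyclic.exists_bound hΩ.isCAR h0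
  exact isHilbertSchmidt_comp_starProjection (C := C) _ fun n e he hV =>
    hC n e (fun i => Q.starProjection (e i)) (fun i => Qᗮ.starProjection (e i)) he
      (fun i => hΩ.isVacuum.apply_eq_zero _ (hV i))
      (fun i => (Q.starProjection_add_starProjection_orthogonal _).symm)
      (fun i j => inner_starProjection_starProjection_orthogonal _ _)
      (fun i => hΦ.apply_eq_zero _ (Q.starProjection_apply_mem _))
      (fun i => hΦ.adjoint_apply_eq_zero _ (Qᗮ.starProjection_apply_mem _))

/-- A vacuum for `Q` in the Fock representation of `V` contains finitely many holes on the
average. -/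
theorem IsFock.isHilbertSchmidt_of_isVacuum' {Ω Φ : F} (hΩ : IsFock ψ V Ω) (hΦ : IsVacuum ψ Q Φ)
    (h0 : Φ ≠ 0) : IsHilbertSchmidt (Q.starProjection ∘L Vᗮ.starProjection) := by
  obtain ⟨C, hC⟩ := hΩ.isCyclic.dualField.exists_bound hΩ.isCAR.dualField h0
  refine isHilbertSchmidt_comp_starProjection (C := C) _ fun n e he hV => ?_
  refine hC n (fun i => ConjSpace.of (e i)) (fun i => ConjSpace.of (Qᗮ.starProjection (e i)))
    (fun i => ConjSpace.of (Q.starProjection (e i))) (orthonormal_conjSpace_of he)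
    (fun i => ?_) (fun i => ?_) (fun i j => ?_) (fun i => ?_) (fun i => ?_)
  · rw [dualField_of]
    exact hΩ.isVacuum.adjoint_apply_eq_zero _ (hV i)
  · rw [← map_add, add_comm, Q.starProjection_add_starProjection_orthogonal]
  · exact inner_starProjection_starProjection_orthogonal (e j) (e i)
  · rw [dualField_of]
    exact hΦ.adjoint_apply_eq_zero _ (Qᗮ.starProjection_apply_mem _)
  · rw [dualField_of, ContinuousLinearMap.adjoint_adjoint]
    exact hΦ.apply_eq_zero _ (Q.starProjection_apply_mem _)

/-- If `Ω` contains finitely many particles on the average, as counted with respect to `Q`, the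
representation has a vacuum for `Q`. -/
theorem IsFock.exists_isVacuum {Ω : F} (hΩ : IsFock ψ V Ω)
    (h1 : IsHilbertSchmidt (Vᗮ.starProjection ∘L Q.starProjection))
    (h2 : IsHilbertSchmidt (V.starProjection ∘L Qᗮ.starProjection)) :
    ∃ Φ : F, Φ ≠ 0 ∧ IsVacuum ψ Q Φ := by
  obtain ⟨w, b, -⟩ := exists_hilbertBasis ℂ Q
  obtain ⟨w', c, -⟩ := exists_hilbertBasis ℂ Qᗮ
  have hb : Summable fun i => ‖ψ (b i) Ω‖ ^ 2 :=
    Summable.of_nonneg_of_le (fun i => by positivity)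
      (fun i => pow_le_pow_left₀ (norm_nonneg _) (hΩ.norm_apply_le (b i).2) 2)
      (h1.hasHSBound.summable (b.orthonormal.comp_linearIsometry Q.subtypeₗᵢ))
  have hc : Summable fun i => ‖((ψ (c i))†) Ω‖ ^ 2 :=
    Summable.of_nonneg_of_le (fun i => by positivity)
      (fun i => pow_le_pow_left₀ (norm_nonneg _) (hΩ.norm_adjoint_apply_le (c i).2) 2)
      (h2.hasHSBound.summable (c.orthonormal.comp_linearIsometry Qᗮ.subtypeₗᵢ))
  obtain ⟨Φ, h0, hΦ⟩ := (hΩ.isCAR.isModeFamily b.orthonormal c.orthonormal).exists_vacuum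
    hΩ.norm_eq_one (Summable.sum _ hb hc)
  exact ⟨Φ, h0, hΩ.isCAR.isVacuum_of_hilbertBasis b c (fun i => hΦ (Sum.inl i))
    (fun j => hΦ (Sum.inr j))⟩

/-- The criterion of Shale and Stinespring: the Fock representations for the polarizations `V` and
`Q` are unitarily equivalent if and only if the off-diagonal parts of the identity with respect to
these polarizations are Hilbert–Schmidt operators. -/
theorem IsFock.exists_unitary_iff {Ω : F} {Ω' : F'} (hΩ : IsFock ψ V Ω) (hΩ' : IsFock ψ' Q Ω') :
    (∃ T : F ≃ₗᵢ[ℂ] F', ∀ f x, T (ψ f x) = ψ' f (T x)) ↔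
      IsHilbertSchmidt (Qᗮ.starProjection ∘L V.starProjection) ∧
        IsHilbertSchmidt (Q.starProjection ∘L Vᗮ.starProjection) := by
  constructor
  · rintro ⟨T, hT⟩
    have hTa (f x) : T (((ψ f)†) x) = ((ψ' f)†) (T x) := by
      refine ext_inner_right ℂ fun y => ?_
      rw [ContinuousLinearMap.adjoint_inner_left, ← T.apply_symm_apply y, T.inner_map_map, ← hT,
        T.inner_map_map, ContinuousLinearMap.adjoint_inner_left]
    have hΦ : IsVacuum ψ Q (T.symm Ω') :=
      ⟨fun f hf => T.injective (by
          rw [hT, T.apply_symm_apply, hΩ'.isVacuum.apply_eq_zero f hf, map_zero]),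
        fun f hf => T.injective (by
          rw [hTa, T.apply_symm_apply, hΩ'.isVacuum.adjoint_apply_eq_zero f hf, map_zero])⟩
    have h0 : T.symm Ω' ≠ 0 := by
      rw [← norm_ne_zero_iff, T.symm.norm_map, hΩ'.norm_eq_one]
      exact one_ne_zero
    exact ⟨hΩ.isHilbertSchmidt_of_isVacuum hΦ h0, hΩ.isHilbertSchmidt_of_isVacuum' hΦ h0⟩
  · rintro ⟨h1, h2⟩
    have h1' := h1.adjoint
    have h2' := h2.adjoint
    rw [adjoint_starProjection_comp] at h1' h2'
    obtain ⟨Φ, h0, hΦ⟩ := hΩ.exists_isVacuum h2' h1'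
    obtain ⟨Φ', h0', hΦ'⟩ := hΩ'.exists_isVacuum h1 h2
    exact hΩ.exists_unitary hΩ' hΦ h0 hΦ' h0'

end Equivalence

/-! ### The Fock space of a polarization carries a Fock representation -/

section Wedge

variable {K : Type*} [NormedAddCommGroup K] [InnerProductSpace ℂ K]

theorem Wedge.invol_invol (x : Wedge K) : invol (invol x) = x :=
  CliffordAlgebra.involute_involute x

theorem Wedge.contract_anticomm (f g : K) (x : Wedge K) :
    contract f (contract g x) = -contract g (contract f x) := by
  have h := contract_contract (f + g) x
  simp only [contract_add, map_add, contract_contract] at h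
  rw [eq_neg_iff_add_eq_zero, add_comm]
  simpa using h

theorem Wedge.ι_mul_anticomm (f g : K) (x : Wedge K) :
    (ι f * (ι g * x) : Wedge K) = -(ι g * (ι f * x)) := by
  have h : (ι f * ι g + ι g * ι f : Wedge K) = 0 := ExteriorAlgebra.ι_add_mul_swap f g
  rw [← mul_assoc, ← mul_assoc, eq_neg_of_add_eq_zero_left h, neg_mul]

theorem AFock.create_coe (f : K) (x : Wedge K) :
    AFock.create f (x : AFock K) = ((Wedge.ι f * x : Wedge K) : AFock K) :=
  ContinuousLinearMap.completion_apply_coe _ x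

theorem AFock.parity_coe (x : Wedge K) :
    AFock.parity K (x : AFock K) = ((Wedge.invol x : Wedge K) : AFock K) :=
  ContinuousLinearMap.completion_apply_coe _ x

theorem AFock.inner_coe (x y : Wedge K) :
    (inner ℂ (x : AFock K) (y : AFock K) : ℂ) = Wedge.form x y :=
  UniformSpace.Completion.inner_coe x y

theorem AFock.annihilate_coe (f : K) (x : Wedge K) :
    AFock.annihilate f (x : AFock K) = ((Wedge.contract f x : Wedge K) : AFock K) := by
  refine ext_inner_left ℂ fun z => ?_
  induction z using UniformSpace.Completion.induction_on with
  | hp => exact isClosed_eq (by fun_prop) (by fun_prop)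
  | ih y =>
    rw [AFock.annihilate, ContinuousLinearMap.adjoint_inner_right, AFock.create_coe,
      AFock.inner_coe, AFock.inner_coe, Wedge.form_ι_mul_left]

end Wedge

section Concrete

variable {H : Type*} [NormedAddCommGroup H] [InnerProductSpace ℂ H] (W : Polarization H)

/-- The vector `x ⊗ y` of the Fock space, with finitely many electrons `x` and holes `y`. -/
def FockSpace.vec (x : Wedge W.Vᗮ) (y : Wedge (ConjSpace W.V)) : FockSpace W :=
  (((x : AFock W.Vᗮ) ⊗ₜ[ℂ] (y : AFock (ConjSpace W.V)) :
    AFock W.Vᗮ ⊗[ℂ] AFock (ConjSpace W.V)) : FockSpace W)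

namespace FockSpace

variable {W}

theorem vec_add_left (x x' : Wedge W.Vᗮ) (y : Wedge (ConjSpace W.V)) :
    vec W (x + x') y = vec W x y + vec W x' y := by
  simp only [vec, UniformSpace.Completion.coe_add, TensorProduct.add_tmul]

theorem vec_add_right (x : Wedge W.Vᗮ) (y y' : Wedge (ConjSpace W.V)) :
    vec W x (y + y') = vec W x y + vec W x y' := by
  simp only [vec, UniformSpace.Completion.coe_add, TensorProduct.tmul_add]

theorem vec_smul_left (c : ℂ) (x : Wedge W.Vᗮ) (y : Wedge (ConjSpace W.V)) :
    vec W (c • x) y = c • vec W x y := by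
  rw [vec, UniformSpace.Completion.coe_smul, ← TensorProduct.smul_tmul',
    UniformSpace.Completion.coe_smul, vec]

theorem vec_smul_right (c : ℂ) (x : Wedge W.Vᗮ) (y : Wedge (ConjSpace W.V)) :
    vec W x (c • y) = c • vec W x y := by
  simp only [vec, UniformSpace.Completion.coe_smul, TensorProduct.tmul_smul]

theorem vec_neg_left (x : Wedge W.Vᗮ) (y : Wedge (ConjSpace W.V)) :
    vec W (-x) y = -vec W x y := by
  rw [← neg_one_smul ℂ, vec_smul_left, neg_one_smul]

theorem vec_neg_right (x : Wedge W.Vᗮ) (y : Wedge (ConjSpace W.V)) :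
    vec W x (-y) = -vec W x y := by
  rw [← neg_one_smul ℂ, vec_smul_right, neg_one_smul]

theorem vec_sub_left (x x' : Wedge W.Vᗮ) (y : Wedge (ConjSpace W.V)) :
    vec W (x - x') y = vec W x y - vec W x' y := by
  rw [sub_eq_add_neg, vec_add_left, vec_neg_left, sub_eq_add_neg]

theorem vec_sub_right (x : Wedge W.Vᗮ) (y y' : Wedge (ConjSpace W.V)) :
    vec W x (y - y') = vec W x y - vec W x y' := by
  rw [sub_eq_add_neg, vec_add_right, vec_neg_right, sub_eq_add_neg]

theorem vec_zero_left (y : Wedge (ConjSpace W.V)) : vec W 0 y = 0 := by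
  simpa using vec_smul_left 0 (0 : Wedge W.Vᗮ) y

theorem vec_zero_right (x : Wedge W.Vᗮ) : vec W x 0 = 0 := by
  simpa using vec_smul_right 0 x (0 : Wedge (ConjSpace W.V))

theorem inner_vec (x x' : Wedge W.Vᗮ) (y y' : Wedge (ConjSpace W.V)) :
    (inner ℂ (vec W x y) (vec W x' y') : ℂ) = Wedge.form x x' * Wedge.form y y' := by
  rw [vec, vec, UniformSpace.Completion.inner_coe, TensorProduct.inner_tmul, AFock.inner_coe,
    AFock.inner_coe]

theorem eq_top_of_vec_mem (R : Submodule ℂ (FockSpace W)) (hR : IsClosed (R : Set (FockSpace W)))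
    (h : ∀ x y, vec W x y ∈ R) : R = ⊤ := by
  have h1 (a : AFock W.Vᗮ) (b : AFock (ConjSpace W.V)) :
      (((a ⊗ₜ[ℂ] b : AFock W.Vᗮ ⊗[ℂ] AFock (ConjSpace W.V))) : FockSpace W) ∈ R := by
    induction a, b using UniformSpace.Completion.induction_on₂ with
    | hp =>
      exact hR.preimage ((UniformSpace.Completion.continuous_coe _).comp
        TensorProduct.continuous_tmul)
    | ih x y => exact h x y
  refine eq_top_iff.2 fun z _ => ?_
  clear * - hR h1
  induction z using UniformSpace.Completion.induction_on with
  | hp => exact hR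
  | ih t =>
    induction t using TensorProduct.induction_on with
    | zero =>
      rw [UniformSpace.Completion.coe_zero]
      exact zero_mem R
    | tmul a b => exact h1 a b
    | add s t hs ht =>
      rw [UniformSpace.Completion.coe_add]
      exact add_mem hs ht

theorem dense_span_vec : Dense (Submodule.span ℂ (Set.range
    fun p : Wedge W.Vᗮ × Wedge (ConjSpace W.V) => vec W p.1 p.2) : Set (FockSpace W)) := by
  rw [Submodule.dense_iff_topologicalClosure_eq_top]
  exact eq_top_of_vec_mem _ (Submodule.isClosed_topologicalClosure _) fun x y =>
    Submodule.le_topologicalClosure _ (Submodule.subset_span ⟨(x, y), rfl⟩)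

theorem continuousLinearMap_ext {E : Type*} [NormedAddCommGroup E] [NormedSpace ℂ E]
    {A B : FockSpace W →L[ℂ] E} (h : ∀ x y, A (vec W x y) = B (vec W x y)) : A = B :=
  ContinuousLinearMap.ext_on dense_span_vec (by rintro _ ⟨p, rfl⟩; exact h p.1 p.2)

theorem norm_vec_one_one : ‖vec W 1 1‖ = 1 := by
  have h (K : Type _) [NormedAddCommGroup K] [InnerProductSpace ℂ K] :
      Wedge.form (1 : Wedge K) 1 = 1 := by
    have := Wedge.form_algebraMap_right (1 : Wedge K) 1
    rwa [map_one, map_one, map_one, one_mul] at this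
  rw [@norm_eq_sqrt_re_inner ℂ, inner_vec, h, h, one_mul, RCLike.one_re, Real.sqrt_one]

variable [CompleteSpace H]

theorem create_vec (f : H) (x : Wedge W.Vᗮ) (y : Wedge (ConjSpace W.V)) :
    create W f (vec W x y) = vec W (Wedge.ι (W.Vᗮ.orthogonalProjectionOnto f) * x) y +
      vec W (Wedge.invol x)
        (Wedge.contract (ConjSpace.of (W.V.orthogonalProjectionOnto f)) y) := by
  rw [create, add_apply, vec, ContinuousLinearMap.completion_apply_coe,
    ContinuousLinearMap.completion_apply_coe, TensorProduct.mapL_tmul, TensorProduct.mapL_tmul,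
    AFock.create_coe, AFock.parity_coe, AFock.annihilate_coe]
  rfl

/-- The annihilation operator removes an electron or creates a hole. -/
theorem adjoint_create_vec (f : H) (x : Wedge W.Vᗮ) (y : Wedge (ConjSpace W.V)) :
    ((create W f)†) (vec W x y) = vec W (Wedge.contract (W.Vᗮ.orthogonalProjectionOnto f) x) y +
      vec W (Wedge.invol x)
        (Wedge.ι (ConjSpace.of (W.V.orthogonalProjectionOnto f)) * y) := by
  refine (innerSL_inj (𝕜 := ℂ)).1 (continuousLinearMap_ext fun x' y' => ?_)
  simp only [innerSL_apply_apply]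
  rw [ContinuousLinearMap.adjoint_inner_left, create_vec, inner_add_right, inner_add_left,
    inner_vec, inner_vec, inner_vec, inner_vec, Wedge.form_ι_mul_right, Wedge.form_ι_mul_left]
  congr 2
  rw [← Wedge.form_invol, Wedge.invol_invol]

variable (W) in
/-- The creation operators as a linear function of the one-particle state. -/
def field : H →ₗ[ℂ] FockSpace W →L[ℂ] FockSpace W where
  toFun := create W
  map_add' f g := continuousLinearMap_ext fun x y => by
    simp only [add_apply, create_vec, map_add, add_mul, vec_add_left, Wedge.contract_add,
      vec_add_right]
    abel
  map_smul' c f := continuousLinearMap_ext fun x y => by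
    have h (v : W.V) : ConjSpace.of (c • v) = conj c • ConjSpace.of v := by
      rw [ConjSpace.smul_of, Complex.conj_conj]
    simp only [smul_apply, create_vec, map_smul, smul_mul_assoc, vec_smul_left, h,
      Wedge.contract_smul, vec_smul_right, Complex.conj_conj, RingHom.id_apply, smul_add]

theorem field_apply (f : H) : field W f = create W f := rfl

theorem isCAR_field : IsCAR (field W) where
  anticomm f g z := by
    refine DFunLike.congr_fun (continuousLinearMap_ext (A := field W f ∘L field W g)
      (B := -(field W g ∘L field W f)) fun x y => ?_) z
    simp only [field_apply, neg_apply, ContinuousLinearMap.comp_apply, create_vec, map_add, map_mul,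
      Wedge.invol_ι, neg_mul, vec_neg_left, Wedge.invol_invol]
    rw [Wedge.ι_mul_anticomm, Wedge.contract_anticomm, vec_neg_left, vec_neg_right]
    abel
  adjoint_apply f g z := by
    refine DFunLike.congr_fun (continuousLinearMap_ext (A := (field W f)† ∘L field W g)
      (B := (inner ℂ f g : ℂ) • .id ℂ _ - field W g ∘L (field W f)†) fun x y => ?_) z
    have h1 : (inner ℂ f g : ℂ) = inner ℂ (W.Vᗮ.orthogonalProjectionOnto f)
          (W.Vᗮ.orthogonalProjectionOnto g) +
        inner ℂ (ConjSpace.of (W.V.orthogonalProjectionOnto g))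
          (ConjSpace.of (W.V.orthogonalProjectionOnto f)) := by
      have h2 : (inner ℂ (W.V.starProjection f) (W.Vᗮ.starProjection g) : ℂ) = 0 :=
        inner_starProjection_starProjection_orthogonal f g
      have h3 : (inner ℂ (W.Vᗮ.starProjection f) (W.V.starProjection g) : ℂ) = 0 := by
        rw [← inner_conj_symm, inner_starProjection_starProjection_orthogonal, map_zero]
      conv_lhs => rw [← W.V.starProjection_add_starProjection_orthogonal f,
        ← W.V.starProjection_add_starProjection_orthogonal g, inner_add_left, inner_add_right,
        inner_add_right, h2, h3, add_zero, zero_add, add_comm]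
      rfl
    simp only [field_apply, sub_apply, smul_apply, ContinuousLinearMap.comp_apply,
      ContinuousLinearMap.id_apply, create_vec, adjoint_create_vec, map_add, map_mul,
      Wedge.invol_ι, neg_mul, vec_neg_left, Wedge.invol_invol, Wedge.contract_ι_mul, vec_sub_left,
      vec_sub_right, vec_smul_left, vec_smul_right, Wedge.contract_invol]
    rw [h1, add_smul]
    abel

theorem isVacuum_field : IsVacuum (field W) W.V (vec W 1 1) := by
  constructor
  · intro f hf
    have h : W.Vᗮ.orthogonalProjectionOnto f = 0 :=
      Submodule.orthogonalProjectionOnto_orthogonal_apply_eq_zero hf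
    rw [field_apply, create_vec, h, map_zero, zero_mul, vec_zero_left, Wedge.contract_one,
      vec_zero_right, add_zero]
  · intro f hf
    have h : W.V.orthogonalProjectionOnto f = 0 :=
      Submodule.orthogonalProjectionOnto_apply_of_mem_orthogonal hf
    rw [field_apply, adjoint_create_vec, h, Wedge.contract_one, map_zero, map_zero, zero_mul,
      vec_zero_left, vec_zero_right, add_zero]

theorem create_electron_vec (u : W.Vᗮ) (x : Wedge W.Vᗮ) (y : Wedge (ConjSpace W.V)) :
    create W u (vec W x y) = vec W (Wedge.ι u * x) y := by
  have h1 : W.V.orthogonalProjectionOnto (u : H) = 0 :=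
    Submodule.orthogonalProjectionOnto_apply_of_mem_orthogonal u.2
  have h2 : Wedge.contract (0 : ConjSpace W.V) y = 0 := by
    have := Wedge.contract_smul 0 (0 : ConjSpace W.V) y
    rwa [zero_smul, map_zero, zero_smul] at this
  rw [create_vec, Submodule.orthogonalProjectionOnto_mem_subspace_eq_self, h1, map_zero, h2,
    vec_zero_right, add_zero]

theorem adjoint_create_hole_vec (v : W.V) (y : Wedge (ConjSpace W.V)) :
    ((create W v)†) (vec W 1 y) = vec W 1 (Wedge.ι (ConjSpace.of v) * y) := by
  rw [adjoint_create_vec, Wedge.contract_one, vec_zero_left, zero_add, map_one,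
    Submodule.orthogonalProjectionOnto_mem_subspace_eq_self]

theorem isCyclic_field : IsCyclic (field W) (vec W 1 1) := by
  intro R hR h0 h1 h2
  have h3 (y : Wedge (ConjSpace W.V)) : vec W 1 y ∈ R := by
    induction y using Wedge.induction with
    | hr r =>
      rw [Algebra.algebraMap_eq_smul_one, vec_smul_right]
      exact R.smul_mem _ h0
    | hadd y y' hy hy' =>
      rw [vec_add_right]
      exact add_mem hy hy'
    | hmul v y hy =>
      obtain ⟨v, rfl⟩ := ConjSpace.of.surjective v
      rw [← adjoint_create_hole_vec]
      exact h2 (v : H) _ hy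
  refine eq_top_of_vec_mem R hR fun x y => ?_
  induction x using Wedge.induction with
  | hr r =>
    rw [Algebra.algebraMap_eq_smul_one, vec_smul_left]
    exact R.smul_mem _ (h3 y)
  | hadd x x' hx hx' =>
    rw [vec_add_left]
    exact add_mem hx hx'
  | hmul u x hx =>
    rw [← create_electron_vec]
    exact h1 (u : H) _ hx

variable (W) in
/-- The creation operators on the Fock space of a polarization form a Fock representation. -/
theorem isFock_field : IsFock (field W) W.V (vec W 1 1) where
  isCAR := isCAR_field
  norm_eq_one := norm_vec_one_one
  isVacuum := isVacuum_field
  isCyclic := isCyclic_field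

end FockSpace

end Concrete

/-! ### Transport along the one-particle evolution -/

section Transport

variable {H H' F : Type*} [NormedAddCommGroup H] [InnerProductSpace ℂ H]
  [NormedAddCommGroup H'] [InnerProductSpace ℂ H']
  [NormedAddCommGroup F] [InnerProductSpace ℂ F] [CompleteSpace F]

theorem mem_orthogonal_comap_iff (U : H ≃ₗᵢ[ℂ] H') (V : Submodule ℂ H') (x : H) :
    x ∈ (V.comap U.toLinearEquiv.toLinearMap)ᗮ ↔ U x ∈ Vᗮ := by
  rw [Submodule.mem_orthogonal, Submodule.mem_orthogonal]
  refine ⟨fun h v hv => ?_, fun h v hv => ?_⟩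
  · rw [← U.apply_symm_apply v, U.inner_map_map]
    exact h _ (by simpa using hv)
  · rw [← U.inner_map_map]
    exact h _ hv

theorem IsFock.comp_equiv {ψ : H' →ₗ[ℂ] F →L[ℂ] F} {V : Submodule ℂ H'} {Ω : F}
    (hΩ : IsFock ψ V Ω) (U : H ≃ₗᵢ[ℂ] H') :
    IsFock (ψ ∘ₗ U.toLinearIsometry.toLinearMap) (V.comap U.toLinearEquiv.toLinearMap) Ω where
  isCAR := hΩ.isCAR.comp _
  norm_eq_one := hΩ.norm_eq_one
  isVacuum := ⟨fun f hf => hΩ.isVacuum.apply_eq_zero (U f) hf, fun f hf =>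
    hΩ.isVacuum.adjoint_apply_eq_zero (U f) ((mem_orthogonal_comap_iff U V f).1 hf)⟩
  isCyclic R hR h0 h1 h2 := by
    refine hΩ.isCyclic R hR h0 (fun f x hx => ?_) fun f x hx => ?_
    · have := h1 (U.symm f) x hx
      change ψ (U (U.symm f)) x ∈ R at this
      rwa [U.apply_symm_apply] at this
    · have := h2 (U.symm f) x hx
      change ((ψ (U (U.symm f)))†) x ∈ R at this
      rwa [U.apply_symm_apply] at this

theorem starProjection_comap (U : H ≃ₗᵢ[ℂ] H') (V : Submodule ℂ H') [V.HasOrthogonalProjection]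
    [(V.comap U.toLinearEquiv.toLinearMap).HasOrthogonalProjection] (x : H) :
    V.starProjection (U x) = U ((V.comap U.toLinearEquiv.toLinearMap).starProjection x) := by
  refine Submodule.eq_starProjection_of_mem_orthogonal
    (Submodule.starProjection_apply_mem (V.comap U.toLinearEquiv.toLinearMap) x) ?_
  rw [← map_sub, ← mem_orthogonal_comap_iff]
  exact Submodule.sub_starProjection_mem_orthogonal x

theorem starProjection_orthogonal_comap (U : H ≃ₗᵢ[ℂ] H') (V : Submodule ℂ H')
    [V.HasOrthogonalProjection] [(V.comap U.toLinearEquiv.toLinearMap).HasOrthogonalProjection]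
    (x : H) :
    Vᗮ.starProjection (U x) = U ((V.comap U.toLinearEquiv.toLinearMap)ᗮ.starProjection x) := by
  rw [← add_right_inj (V.starProjection (U x)), V.starProjection_add_starProjection_orthogonal,
    starProjection_comap, ← map_add, Submodule.starProjection_add_starProjection_orthogonal]

theorem isHilbertSchmidt_congr {E E' : Type*} [CompleteSpace H] [NormedAddCommGroup E]
    [InnerProductSpace ℂ E] [CompleteSpace E] [NormedAddCommGroup E'] [InnerProductSpace ℂ E']
    [CompleteSpace E'] {S : H →L[ℂ] E} {T : H →L[ℂ] E'} (h : ∀ x, ‖S x‖ = ‖T x‖) :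
    IsHilbertSchmidt S ↔ IsHilbertSchmidt T := by
  simp only [IsHilbertSchmidt, h]

/-- The criterion of Shale and Stinespring for the implementability of a unitary one-particle map
between the Fock spaces of two polarizations. -/
theorem exists_implementer_iff [CompleteSpace H] [CompleteSpace H'] (U : H ≃ₗᵢ[ℂ] H')
    (W : Polarization H) (W' : Polarization H') :
    (∃ T : FockSpace W ≃ₗᵢ[ℂ] FockSpace W', ∀ (f : H) (Ψ : FockSpace W'),
      T (FockSpace.create W f (T.symm Ψ)) = FockSpace.create W' (U f) Ψ) ↔
    (IsHilbertSchmidt (W'.Vᗮ.starProjection ∘L (U.toContinuousLinearEquiv : H →L[ℂ] H') ∘L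
        W.V.starProjection) ∧
      IsHilbertSchmidt (W'.V.starProjection ∘L (U.toContinuousLinearEquiv : H →L[ℂ] H') ∘L
        W.Vᗮ.starProjection)) := by
  have hc : CompleteSpace (W'.V.comap U.toLinearEquiv.toLinearMap) :=
    (W'.isClosed.preimage U.continuous).completeSpace_coe
  have hF := FockSpace.isFock_field W
  have hF' := (FockSpace.isFock_field W').comp_equiv U
  have key := hF.exists_unitary_iff hF'
  have h1 : IsHilbertSchmidt (W'.Vᗮ.starProjection ∘L
      (U.toContinuousLinearEquiv : H →L[ℂ] H') ∘L W.V.starProjection) ↔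
      IsHilbertSchmidt ((W'.V.comap U.toLinearEquiv.toLinearMap)ᗮ.starProjection ∘L
        W.V.starProjection) := by
    refine isHilbertSchmidt_congr fun x => ?_
    change ‖W'.Vᗮ.starProjection (U (W.V.starProjection x))‖ = _
    rw [starProjection_orthogonal_comap, U.norm_map]
    rfl
  have h2 : IsHilbertSchmidt (W'.V.starProjection ∘L
      (U.toContinuousLinearEquiv : H →L[ℂ] H') ∘L W.Vᗮ.starProjection) ↔
      IsHilbertSchmidt ((W'.V.comap U.toLinearEquiv.toLinearMap).starProjection ∘L
        W.Vᗮ.starProjection) := by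
    refine isHilbertSchmidt_congr fun x => ?_
    change ‖W'.V.starProjection (U (W.Vᗮ.starProjection x))‖ = _
    rw [starProjection_comap, U.norm_map]
    rfl
  refine Iff.trans (exists_congr fun T => ?_) (key.trans (and_congr h1.symm h2.symm))
  refine ⟨fun h f x => ?_, fun h f x => ?_⟩
  · have := h f (T x)
    rwa [T.symm_apply_apply] at this
  · have := h f (T.symm x)
    rwa [T.apply_symm_apply] at this

end Transport

end DiracSea

end

theorem mainTheorem5
    (m e : ℝ) (A : DiracSea.Spacetime → Fin 4 → ℝ) (hA : ContDiff ℝ ∞ A)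
    (hAc : HasCompactSupport A)
    (S S' : DiracSea.CauchySurface)
    (U : DiracSea.HSpace S ≃ₗᵢ[ℂ] DiracSea.HSpace S')
    (hU : DiracSea.IsDiracEvolution m e A S S' U)
    (W : DiracSea.Polarization (DiracSea.HSpace S))
    (W' : DiracSea.Polarization (DiracSea.HSpace S')) :
    (∃ T : DiracSea.FockSpace W ≃ₗᵢ[ℂ] DiracSea.FockSpace W',
      ∀ (f : DiracSea.HSpace S) (Ψ : DiracSea.FockSpace W'),
        T (DiracSea.FockSpace.create W f (T.symm Ψ)) = DiracSea.FockSpace.create W' (U f) Ψ) ↔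
    (DiracSea.IsHilbertSchmidt (W'.Vᗮ.starProjection ∘L
        (U.toContinuousLinearEquiv : DiracSea.HSpace S →L[ℂ] DiracSea.HSpace S') ∘L
        W.V.starProjection) ∧
      DiracSea.IsHilbertSchmidt (W'.V.starProjection ∘L
        (U.toContinuousLinearEquiv : DiracSea.HSpace S →L[ℂ] DiracSea.HSpace S') ∘L
        W.Vᗮ.starProjection)) :=
  DiracSea.exists_implementer_iff U W W'
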